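/- Let $k \ge 1$, let $\ell_1,\dots,\ell_4$ be four pairwise distinct lines and let $C_1,\dots,C_k$ be $k$ pairwise distinct smooth conics in the complex projective plane $\mathbb{P}^2_{\mathbb{C}}$. Let $f \in S=\mathbb{C}[x,y,z]$ be the product of their defining equations, so that $f=0$ is a reduced curve of degree $2k+4$, and suppose that every singular point of this curve is a node, a tacnode or an ordinary triple point (that is, the germ of the curve there is isomorphic to the germ at the origin of $xy=0$, of $y(y-x^2)=0$, or of $xy(x+y)=0$, respectively). Then the arrangement is not free. Here the curve $f=0$ is called free if $N(f)=I_f/J_f=0$, where $J_f=\langle \partial_x f,\partial_y f,\partial_z f\rangle$ is the Jacobian ideal of $f$ and $I_f$ is its saturation with respect to the ideal $\langle x,y,z\rangle$. -/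

import Mathlib

noncomputable section

namespace ConicLine

/-- The homogeneous coordinate ring `S = ℂ[x, y, z]` of the complex projective plane. -/
abbrev S : Type := MvPolynomial (Fin 3) ℂ

/-- The ring `ℂ⟦x, y⟧` of formal power series, with `x = X 0` and `y = X 1`. -/
abbrev R : Type := MvPowerSeries (Fin 2) ℂ

/-! ### Free curves -/

/-- The Jacobian ideal `J_f`, generated by the three partial derivatives of `f`. -/
def jacobianIdeal (f : S) : Ideal S :=
  Ideal.span (Set.range fun i : Fin 3 => MvPolynomial.pderiv i f)

/-- The irrelevant ideal `𝔪 = (x, y, z)`. -/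
def irrelevantIdeal : Ideal S :=
  Ideal.span (Set.range fun i : Fin 3 => (MvPolynomial.X i : S))

/-- The saturation `⋃ₙ (J : 𝔪ⁿ)` of an ideal with respect to `𝔪`
(the union is increasing, so it is the supremum). -/
def saturation (J : Ideal S) : Ideal S :=
  ⨆ n : ℕ, Submodule.colon J ((irrelevantIdeal ^ n : Ideal S) : Set S)

/-- The module `N(f) = I_f / J_f`, where `I_f` is the saturation of `J_f`. -/
abbrev moduleN (f : S) : Type :=
  ↥(saturation (jacobianIdeal f)) ⧸
    Submodule.submoduleOf (jacobianIdeal f) (saturation (jacobianIdeal f))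

/-- The plane curve `f = 0` is free: `N(f) = 0`. -/
def IsFree (f : S) : Prop := Subsingleton (moduleN f)

/-! ### Singular points and their types -/

/-- The curve `f = 0` passes through the point with homogeneous coordinates `v`
and is singular there. -/
def IsSingularAt (f : S) (v : Fin 3 → ℂ) : Prop :=
  MvPolynomial.eval v f = 0 ∧ ∀ i, MvPolynomial.eval v (MvPolynomial.pderiv i f) = 0

/-- The equation `f (v + x w₁ + y w₂)` in `ℂ⟦x, y⟧`. If `v, w₁, w₂` is a basis of `ℂ³`, this is
the equation of the curve `f = 0` in the affine coordinates `x, y` centred at the point `[v]`. -/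
def localEquation (f : S) (v w₁ w₂ : Fin 3 → ℂ) : R :=
  MvPolynomial.aeval
    (fun i : Fin 3 => (MvPowerSeries.C (v i) + MvPowerSeries.C (w₁ i) * MvPowerSeries.X 0
      + MvPowerSeries.C (w₂ i) * MvPowerSeries.X 1 : R)) f

/-- The germ of the curve `f = 0` at the point `[v]` is isomorphic to the germ of `g = 0` at the
origin: in suitable formal coordinates, the local equation of the curve is `g` up to a unit. -/
def HasLocalType (f : S) (v : Fin 3 → ℂ) (g : R) : Prop :=
  ∃ w₁ w₂ : Fin 3 → ℂ, LinearIndependent ℂ ![v, w₁, w₂] ∧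
    ∃ φ : R ≃ₐ[ℂ] R, Associated (φ (localEquation f v w₁ w₂)) g

/-- A node (`A₁`): two smooth branches crossing transversally, locally `x y = 0`. -/
def IsNode (f : S) (v : Fin 3 → ℂ) : Prop :=
  HasLocalType f v (MvPowerSeries.X 0 * MvPowerSeries.X 1)

/-- A tacnode (`A₃`): two smooth branches with a simple tangency, locally `y (y - x²) = 0`
(equivalently `y² + x⁴ = 0`). -/
def IsTacnode (f : S) (v : Fin 3 → ℂ) : Prop :=
  HasLocalType f v (MvPowerSeries.X 1 * (MvPowerSeries.X 1 - MvPowerSeries.X 0 ^ 2))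

/-- An ordinary triple point (`D₄`): three smooth branches with distinct tangents, locally
`x y (x + y) = 0` (equivalently `x³ + y³ = 0`). -/
def IsOrdinaryTriplePoint (f : S) (v : Fin 3 → ℂ) : Prop :=
  HasLocalType f v
    (MvPowerSeries.X 0 * MvPowerSeries.X 1 * (MvPowerSeries.X 0 + MvPowerSeries.X 1))

/-- All singular points of the curve `f = 0` in the projective plane are nodes, tacnodes or
ordinary triple points. -/
def OnlyNodesTacnodesTriplePoints (f : S) : Prop :=
  ∀ v : Fin 3 → ℂ, v ≠ 0 → IsSingularAt f v →
    IsNode f v ∨ IsTacnode f v ∨ IsOrdinaryTriplePoint f v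

/-! ### Conic-line arrangements -/

/-- An arrangement of `d` pairwise distinct lines and `k` pairwise distinct smooth conics in the
complex projective plane, given by their equations. -/
structure Arrangement (d k : ℕ) where
  line : Fin d → S
  conic : Fin k → S
  line_isHomogeneous : ∀ i, (line i).IsHomogeneous 1
  line_ne_zero : ∀ i, line i ≠ 0
  line_distinct : ∀ i j, i ≠ j → ¬ Associated (line i) (line j)
  conic_isHomogeneous : ∀ i, (conic i).IsHomogeneous 2
  conic_smooth : ∀ i, ∀ v : Fin 3 → ℂ, v ≠ 0 → ¬ IsSingularAt (conic i) v
  conic_distinct : ∀ i j, i ≠ j → ¬ Associated (conic i) (conic j)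

/-- The equation of the union of all the lines and conics of the arrangement. -/
def Arrangement.equation {d k : ℕ} (A : Arrangement d k) : S :=
  (∏ i, A.line i) * ∏ j, A.conic j

end ConicLine

end

noncomputable section

namespace ConicLine

open MvPolynomial

/-! ### Homogeneous polynomials along a polynomial curve -/

/-! Suppose the curve is free. Then some linear form `L` is a nonzerodivisor modulo the Jacobian
ideal, so relations among the partial derivatives on the line `L = 0` lift to the plane, and a
dimension count gives at least four independent syzygies of degree `k + 2`
(`IsFree.finrank_syzygies_succ`). Contraction with the Euler field turns them into four independent
1-forms of degree `k + 3` leaving every component invariant (`finrank_syzygies_le`).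

In the other direction, an invariant form restricts to a component of degree `e` as a multiple of
the gradient. The multiplier has bounded degree and vanishes wherever the component meets other
curves; if it is zero, the form can be divided by the equation
(`IsSystem.finrank_logForms_insert_le`). The allowed singularities bound the total intersection
multiplicity of a component with the others by two at each point (`rootMultiplicity_le_two`), so by
Bézout there are many such points. It follows that conics together with three nonconcurrent lines
have no invariant forms of small degree (`IsSystem.logForms_triangle_eq_zero`).

Let `a` be a line such that the other three are not concurrent, and `c` a conic. Removing `c` and
then `a` bounds the dimension by 3 + 1 + 0, so every estimate is sharp (`IsSystem.card_points`).
Hence every intersection point on `c` has multiplicity exactly two, and `a` meets the curves other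
than `c` with at most one simple point. A line meeting `c` in two points would have two simple
points, so `a` is tangent to every conic. Three concurrent lines cannot all be tangent to a smooth
conic, which excludes concurrent triples. Each line then meets the other lines in distinct points
off the conics; these are simple and there is more than one, a contradiction. -/

theorem dvd_aeval_sub_aeval {P : S} {a b : Fin 3 → S} (h : ∀ i, P ∣ a i - b i) (G : S) :
    P ∣ aeval a G - aeval b G := by
  rw [← Ideal.mem_span_singleton, ← Ideal.Quotient.eq]
  have key : ∀ c : Fin 3 → S, Ideal.Quotient.mk (Ideal.span {P}) (aeval c G) =
      aeval (fun i => Ideal.Quotient.mk (Ideal.span {P}) (c i)) G := by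
    intro c
    have := MvPolynomial.map_aeval c (Ideal.Quotient.mk (Ideal.span {P})) G
    rw [this, MvPolynomial.aeval_def]
    rfl
  rw [key, key]
  congr 2
  funext i
  rw [Ideal.Quotient.eq, Ideal.mem_span_singleton]
  exact h i

theorem IsHomogeneous.aeval_mul {A : Type*} [CommRing A] [Algebra ℂ A] {G : S} {d : ℕ}
    (hG : G.IsHomogeneous d) (c : A) (y : Fin 3 → A) :
    aeval (fun i => c * y i) G = c ^ d * aeval y G := by
  rw [aeval_def, aeval_def, eval₂_eq', eval₂_eq', Finset.mul_sum]
  refine Finset.sum_congr rfl fun m hm => ?_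
  have hd : ∑ i, m i = d := by
    rw [hG.degree_eq_sum_deg_support hm]
    exact (Finset.sum_subset (Finset.subset_univ _) (by simp)).symm
  simp only [mul_pow, Finset.prod_mul_distrib, Finset.prod_pow_eq_pow_sum, hd]
  ring

theorem IsHomogeneous.eval_smul {G : S} {d : ℕ} (hG : G.IsHomogeneous d) (c : ℂ)
    (y : Fin 3 → ℂ) : eval (c • y) G = c ^ d * eval y G :=
  IsHomogeneous.aeval_mul hG c y

theorem eval_aeval_polynomial (φ : Fin 3 → Polynomial ℂ) (t : ℂ) (G : S) :
    (aeval φ G).eval t = eval (fun i => (φ i).eval t) G := by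
  have := DFunLike.congr_fun (MvPolynomial.comp_aeval φ (Polynomial.aeval (R := ℂ) t)) G
  simp only [AlgHom.comp_apply, Polynomial.coe_aeval_eq_eval] at this
  rw [this]
  rfl

theorem homogenize_aeval {φ : Fin 3 → Polynomial ℂ} {e d : ℕ} (hφ : ∀ i, (φ i).natDegree ≤ e)
    {G : S} (hG : G.IsHomogeneous d) :
    (aeval φ G).homogenize (e * d) = aeval (fun i => (φ i).homogenize e) G := by
  apply Polynomial.homogenize_eq_of_isHomogeneous
  · exact hG.aeval _ fun i => Polynomial.isHomogeneous_homogenize _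
  · rw [← AlgHom.comp_apply, MvPolynomial.comp_aeval]
    congr 2
    funext i
    exact Polynomial.aeval_homogenize_X_one _ (hφ i)

theorem natDegree_aeval_le {φ : Fin 3 → Polynomial ℂ} {e d : ℕ} (hφ : ∀ i, (φ i).natDegree ≤ e)
    {G : S} (hG : G.IsHomogeneous d) : (aeval φ G).natDegree ≤ e * d := by
  rw [aeval_def, eval₂_eq']
  refine Polynomial.natDegree_sum_le_of_forall_le _ _ fun m hm => ?_
  have hd : ∑ i, m i = d := by
    rw [hG.degree_eq_sum_deg_support hm]
    exact (Finset.sum_subset (Finset.subset_univ _) (by simp)).symm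
  refine (Polynomial.natDegree_C_mul_le _ _).trans ?_
  refine (Polynomial.natDegree_prod_le _ _).trans ?_
  rw [← hd, Finset.mul_sum]
  refine Finset.sum_le_sum fun i _ => Polynomial.natDegree_pow_le.trans ?_
  rw [mul_comm]
  exact Nat.mul_le_mul_right _ (hφ i)

theorem eval_one_zero_homogenize (p : Polynomial ℂ) (n : ℕ) :
    aeval (![1, 0] : Fin 2 → ℂ) (p.homogenize n) = p.coeff n := by
  rw [Polynomial.homogenize, map_sum, Finset.sum_eq_single (n, 0)]
  · simp [aeval_monomial, Finsupp.prod_fintype]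
  · rintro ⟨a, b⟩ hab hne
    have hb : b ≠ 0 := by
      rintro rfl
      simp_all
    simp [aeval_monomial, Finsupp.prod_fintype, hb]
  · simp

/-- The coefficient in the largest possible degree is the value at the point at infinity of the
parametrization, so the degree drops exactly when `G` vanishes there. -/
theorem coeff_aeval {φ : Fin 3 → Polynomial ℂ} {e d : ℕ} (hφ : ∀ i, (φ i).natDegree ≤ e)
    {G : S} (hG : G.IsHomogeneous d) :
    (aeval φ G).coeff (e * d) = eval (fun i => (φ i).coeff e) G := by
  rw [← eval_one_zero_homogenize, homogenize_aeval hφ hG, ← AlgHom.comp_apply,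
    MvPolynomial.comp_aeval]
  simp_rw [eval_one_zero_homogenize]
  rfl

theorem derivative_aeval (φ : Fin 3 → Polynomial ℂ) (G : S) :
    Polynomial.derivative (aeval φ G) =
      ∑ i, aeval φ (pderiv i G) * Polynomial.derivative (φ i) := by
  induction G using MvPolynomial.induction_on with
  | C a => simp
  | add p q hp hq => simp only [map_add, hp, hq, add_mul, Finset.sum_add_distrib]
  | mul_X p j hp =>
    simp only [map_mul, Polynomial.derivative_mul, hp, Derivation.leibniz, smul_eq_mul, map_add,
      aeval_X, add_mul, Finset.sum_add_distrib, pderiv_X, Finset.sum_mul]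
    have h1 : ∑ x, (aeval φ) p * (aeval φ) ((Pi.single x (1 : S) : Fin 3 → S) j) *
        Polynomial.derivative (φ x) = (aeval φ) p * Polynomial.derivative (φ j) := by
      rw [Finset.sum_eq_single j]
      · simp
      · intro b _ hb
        simp [hb.symm]
      · simp
    rw [h1, add_comm]
    exact congrArg _ (Finset.sum_congr rfl fun i _ => by ring)

/-! ### Homogeneous factors and linear forms. -/

section
attribute [local instance] MvPolynomial.gradedAlgebra

theorem coe_decompose_eq (p : S) (n : ℕ) :
    (DirectSum.decompose (homogeneousSubmodule (Fin 3) ℂ) p n : S) = homogeneousComponent n p :=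
  decomposition.decompose'_apply p n

theorem homogeneousComponent_mul_of_left {p : S} {m : ℕ} (hp : p.IsHomogeneous m) (q : S)
    (n : ℕ) : homogeneousComponent (m + n) (p * q) = p * homogeneousComponent n q := by
  have := DirectSum.coe_decompose_mul_add_of_left_mem (homogeneousSubmodule (Fin 3) ℂ)
    (a := p) (b := q) (i := m) (j := n) hp
  simpa only [coe_decompose_eq] using this

theorem homogeneousComponent_mul_of_lt {p : S} {m : ℕ} (hp : p.IsHomogeneous m) (q : S)
    {n : ℕ} (h : n < m) : homogeneousComponent n (p * q) = 0 := by
  have := DirectSum.coe_decompose_mul_of_left_mem_of_not_le (homogeneousSubmodule (Fin 3) ℂ)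
    (a := p) (b := q) (i := m) (n := n) hp (by omega)
  simpa only [coe_decompose_eq] using this

end

theorem exists_isHomogeneous_of_dvd {p g : S} {m d : ℕ} (hp : p.IsHomogeneous m)
    (hg : g.IsHomogeneous d) (h : p ∣ g) :
    ∃ q : S, q.IsHomogeneous (d - m) ∧ g = p * q ∧ (d < m → q = 0) := by
  obtain ⟨q, rfl⟩ := h
  rcases lt_or_ge d m with hd | hd
  -- Here `d - m` truncates to zero; the product must vanish, and zero is homogeneous of every
  -- degree.
  · refine ⟨0, isHomogeneous_zero _ _ _, ?_, fun _ => rfl⟩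
    rw [mul_zero, ← homogeneousComponent_mul_of_lt hp q hd, homogeneousComponent_eq_self hg]
  · refine ⟨homogeneousComponent (d - m) q, homogeneousComponent_isHomogeneous _ _, ?_, by omega⟩
    rw [← homogeneousComponent_mul_of_left hp, Nat.add_sub_cancel' hd,
      homogeneousComponent_eq_self hg]

theorem prime_of_isHomogeneous_one {p : S} (hp : p.IsHomogeneous 1) (h0 : p ≠ 0) : Prime p := by
  apply Irreducible.prime
  apply irreducible_of_totalDegree_eq_one (hp.totalDegree h0)
  intro x hx
  rw [isUnit_iff_ne_zero]
  rintro rfl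
  apply h0
  ext m
  simpa using hx m

theorem eq_zero_of_dvd_of_lt {p g : S} {m d : ℕ} (hp : p.IsHomogeneous m)
    (hg : g.IsHomogeneous d) (h : p ∣ g) (hd : d < m) : g = 0 := by
  obtain ⟨q, -, rfl, hq⟩ := exists_isHomogeneous_of_dvd hp hg h
  rw [hq hd, mul_zero]

/-- Linear form with given coefficients. -/
def linForm (a : Fin 3 → ℂ) : S := ∑ i, C (a i) * X i

theorem linForm_isHomogeneous (a : Fin 3 → ℂ) : (linForm a).IsHomogeneous 1 :=
  IsHomogeneous.sum _ _ _ fun _ _ => isHomogeneous_C_mul_X _ _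

theorem aeval_linForm {A : Type*} [CommRing A] [Algebra ℂ A] (a : Fin 3 → ℂ) (y : Fin 3 → A) :
    aeval y (linForm a) = ∑ i, algebraMap ℂ A (a i) * y i := by
  simp [linForm, map_sum]

theorem eval_linForm (a y : Fin 3 → ℂ) : eval y (linForm a) = ∑ i, a i * y i := by
  simp [linForm, map_sum]

theorem exists_eq_linForm {p : S} (hp : p.IsHomogeneous 1) : ∃ a, p = linForm a := by
  have h := hp
  rw [← mem_homogeneousSubmodule, homogeneousSubmodule_one_eq_span_X,
    Submodule.mem_span_range_iff_exists_fun] at h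
  obtain ⟨c, rfl⟩ := h
  exact ⟨c, by simp [linForm, smul_eq_C_mul]⟩

theorem pderiv_linForm (a : Fin 3 → ℂ) (i : Fin 3) : pderiv i (linForm a) = C (a i) := by
  simp only [linForm, map_sum, Derivation.leibniz, pderiv_X, pderiv_C, smul_eq_mul]
  rw [Finset.sum_eq_single i]
  · simp
  · intro b _ hb
    simp [hb.symm]
  · simp

theorem linForm_eq_zero_iff (a : Fin 3 → ℂ) : linForm a = 0 ↔ a = 0 := by
  constructor
  · intro h
    funext i
    have := pderiv_linForm a i
    rw [h, map_zero] at this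
    exact (C_eq_zero.mp this.symm)
  · rintro rfl
    simp [linForm]

/-! ### Rational parametrizations of lines and conics -/

/-- `φ` is an affine polynomial parametrization, of degree at most `e`, of the curve `P = 0`;
the only point of the curve it misses is the one with coordinates the coefficients of degree `e`. -/
structure IsParam (P : S) (e : ℕ) (φ : Fin 3 → Polynomial ℂ) : Prop where
  natDegree_le : ∀ i, (φ i).natDegree ≤ e
  aeval_eq_zero : aeval φ P = 0
  dvd_of_aeval_eq_zero : ∀ (G : S) (d : ℕ), G.IsHomogeneous d → aeval φ G = 0 → P ∣ G
  exists_local : ∀ t : ℂ, ∃ u v : S, eval (fun i => (φ i).eval t) u = 1 ∧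
    eval (fun i => (φ i).eval t) v = 0 ∧ ∀ (G : S) (d n : ℕ), G.IsHomogeneous d →
      (Polynomial.X - Polynomial.C t) ^ n ∣ aeval φ G → ∃ (N : ℕ) (h : S), P ∣ u ^ N * G - v ^ n * h
  injective : ∀ t t' c : ℂ, (∀ i, (φ i).eval t = c * (φ i).eval t') → t = t'
  lead_ne_zero : ∃ i, (φ i).coeff e ≠ 0
  exists_eq : ∀ y : Fin 3 → ℂ, eval y P = 0 →
    (∃ t c : ℂ, ∀ i, y i = c * (φ i).eval t) ∨ ∃ c : ℂ, ∀ i, y i = c * (φ i).coeff e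

theorem aeval_homogenize_X_sub_C_pow (u v : S) (t : ℂ) (n : ℕ) :
    aeval ![v, u] (((Polynomial.X - Polynomial.C t) ^ n).homogenize n) = (v - C t * u) ^ n := by
  induction n with
  | zero => simp
  | succ n ih =>
    rw [pow_succ, Polynomial.homogenize_mul (m := n) (n := 1), map_mul, ih, pow_succ]
    · simp
    · simp
    · simp

theorem pow_dvd_aeval_homogenize (u v : S) (t : ℂ) {n m : ℕ} {p : Polynomial ℂ}
    (hp : p.natDegree ≤ m) (h : (Polynomial.X - Polynomial.C t) ^ n ∣ p) :
    (v - C t * u) ^ n ∣ aeval ![v, u] (p.homogenize m) := by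
  obtain ⟨q, rfl⟩ := h
  rcases eq_or_ne q 0 with rfl | hq
  · simp
  · have h0 : (Polynomial.X - Polynomial.C t) ^ n ≠ 0 := pow_ne_zero _ (Polynomial.X_sub_C_ne_zero t)
    rw [Polynomial.natDegree_mul h0 hq, Polynomial.natDegree_pow, Polynomial.natDegree_X_sub_C,
      mul_one] at hp
    obtain ⟨k, rfl⟩ := Nat.exists_eq_add_of_le (le_of_add_le_left hp)
    rw [Polynomial.homogenize_mul (m := n) (n := k), map_mul, aeval_homogenize_X_sub_C_pow]
    · exact dvd_mul_right _ _
    · simp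
    · omega

/-- The ratio `v / u` inverts the parametrization where `u ≠ 0`. Modulo `P`, a power of `u` times
`G` equals the homogenization of `aeval φ G` evaluated at `(v, u)`; both the divisibility and the
local clause of `IsParam` are read off this congruence. -/
theorem IsParam.mk_of_forms {P u v : S} {e : ℕ} {φ : Fin 3 → Polynomial ℂ}
    (hdeg : ∀ i, (φ i).natDegree ≤ e) (hP : aeval φ P = 0) (hrel : IsRelPrime P u)
    (hu : aeval φ u = 1) (hv : aeval φ v = Polynomial.X) (hu1 : u.IsHomogeneous 1)
    (he : 1 ≤ e)
    (hX : ∀ i, P ∣ u ^ (e - 1) * X i - aeval ![v, u] ((φ i).homogenize e))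
    (hlead : ∃ i, (φ i).coeff e ≠ 0)
    (hinf : ∀ y, eval y P = 0 → eval y u = 0 → ∃ c : ℂ, ∀ i, y i = c * (φ i).coeff e) :
    IsParam P e φ := by
  have hu' : ∀ t, eval (fun i => (φ i).eval t) u = 1 := fun t => by
    rw [← eval_aeval_polynomial, hu, Polynomial.eval_one]
  have hv' : ∀ t, eval (fun i => (φ i).eval t) v = t := fun t => by
    rw [← eval_aeval_polynomial, hv, Polynomial.eval_X]
  have key : ∀ (G : S) (d : ℕ), G.IsHomogeneous d →
      P ∣ u ^ ((e - 1) * d) * G - aeval ![v, u] ((aeval φ G).homogenize (e * d)) := by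
    intro G d hG
    have h1 := dvd_aeval_sub_aeval hX G
    rw [IsHomogeneous.aeval_mul hG, aeval_X_left_apply, ← pow_mul] at h1
    rw [homogenize_aeval hdeg hG, ← AlgHom.comp_apply, comp_aeval]
    exact h1
  refine ⟨hdeg, hP, ?_, ?_, ?_, hlead, ?_⟩
  · intro G d hG h
    have := key G d hG
    rw [h, Polynomial.homogenize_zero, map_zero, sub_zero] at this
    exact (hrel.pow_right).dvd_of_dvd_mul_left this
  · intro t
    -- The form `v - C t * u` restricts to `X - t` on the curve, hence serves as local parameter at
    -- the point with parameter `t`.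
    refine ⟨u, v - C t * u, hu' t, by simp [hu', hv'], ?_⟩
    intro G d n hG h
    obtain ⟨q, hq⟩ := pow_dvd_aeval_homogenize u v t (natDegree_aeval_le hdeg hG) h
    exact ⟨(e - 1) * d, q, hq ▸ key G d hG⟩
  · intro t t' c h
    have h' : (fun i => (φ i).eval t) = c • (fun i => (φ i).eval t') := funext h
    have h1 := hu' t
    have h2 := hv' t
    rw [h', IsHomogeneous.eval_smul hu1, hu', pow_one, mul_one] at h1
    subst h1
    rw [one_smul] at h'
    rw [h', hv'] at h2
    exact h2.symm
  · intro y hy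
    by_cases h0 : eval y u = 0
    · exact Or.inr (hinf y hy h0)
    · refine Or.inl ⟨eval y v / eval y u, eval y u, fun i => ?_⟩
      obtain ⟨q, hq⟩ := hX i
      have h1 := congrArg (eval y) hq
      rw [map_mul, hy, zero_mul, map_sub, map_mul, map_pow, eval_X] at h1
      have h2 : eval y (aeval ![v, u] ((φ i).homogenize e)) =
          eval ![eval y v, eval y u] ((φ i).homogenize e) := by
        have := DFunLike.congr_fun (comp_aeval ![v, u] (aeval y : S →ₐ[ℂ] ℂ)) ((φ i).homogenize e)
        simp only [AlgHom.comp_apply] at this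
        refine Eq.trans this ?_
        have h3 : (fun j => aeval y (![v, u] j)) = ![eval y v, eval y u] := by
          funext j
          fin_cases j <;> rfl
        rw [h3]
        rfl
      rw [h2, Polynomial.eval_homogenize (hdeg i) _ (by simpa using h0)] at h1
      simp only [Matrix.cons_val_zero, Matrix.cons_val_one] at h1
      have h4 : eval y u ^ e = eval y u ^ (e - 1) * eval y u := by
        rw [← pow_succ, Nat.sub_add_cancel he]
      rw [h4] at h1
      have h5 := pow_ne_zero (e - 1) h0
      apply mul_left_cancel₀ h5
      linear_combination h1

/-- A basis `b` of `ℂ³` together with the dual basis `l` of linear forms. -/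
structure IsFrame (b : Fin 3 → Fin 3 → ℂ) (l : Fin 3 → S) : Prop where
  isHomogeneous : ∀ j, (l j).IsHomogeneous 1
  X_eq : ∀ i, X i = ∑ j, C (b j i) * l j
  eval_eq : ∀ j k, eval (b k) (l j) = if j = k then 1 else 0

theorem exists_isFrame {b : Fin 3 → Fin 3 → ℂ} (hb : LinearIndependent ℂ b) :
    ∃ l, IsFrame b l := by
  have hB : IsUnit (Matrix.of b) := Matrix.linearIndependent_rows_iff_isUnit.mp hb
  have hdet : IsUnit (Matrix.of b).det := (Matrix.isUnit_iff_isUnit_det _).mp hB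
  have h1 := Matrix.mul_nonsing_inv _ hdet
  have h2 := Matrix.nonsing_inv_mul _ hdet
  refine ⟨fun j => linForm fun i => (Matrix.of b)⁻¹ i j, fun j => linForm_isHomogeneous _, ?_, ?_⟩
  · intro i
    apply MvPolynomial.funext
    intro y
    simp only [eval_X, map_sum, map_mul, eval_C, eval_linForm, Finset.mul_sum]
    rw [Finset.sum_comm]
    have h3 : ∀ m, ∑ j, b j i * ((Matrix.of b)⁻¹ m j * y m) = (if m = i then 1 else 0) * y m := by
      intro m
      have h4 := congrFun (congrFun h2 m) i
      rw [Matrix.mul_apply, Matrix.one_apply] at h4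
      rw [← h4, Finset.sum_mul]
      exact Finset.sum_congr rfl fun j _ => by simp only [Matrix.of_apply]; ring
    simp [h3]
  · intro j k
    rw [eval_linForm]
    have h4 := congrFun (congrFun h1 k) j
    rw [Matrix.mul_apply, Matrix.one_apply] at h4
    simp only [Matrix.of_apply] at h4
    simp only [eq_comm (a := j), ← h4]
    exact Finset.sum_congr rfl fun i _ => by ring

theorem IsFrame.coord_eq {b : Fin 3 → Fin 3 → ℂ} {l : Fin 3 → S} (h : IsFrame b l)
    (y : Fin 3 → ℂ) (i : Fin 3) : y i = ∑ j, b j i * eval y (l j) := by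
  have := congrArg (eval y) (h.X_eq i)
  simpa using this

theorem IsFrame.l_ne_zero {b : Fin 3 → Fin 3 → ℂ} {l : Fin 3 → S} (h : IsFrame b l) (j : Fin 3) :
    l j ≠ 0 := by
  intro h0
  have := h.eval_eq j j
  rw [h0] at this
  simp at this

theorem IsFrame.exists_ne_zero {b : Fin 3 → Fin 3 → ℂ} {l : Fin 3 → S} (h : IsFrame b l)
    (j : Fin 3) : ∃ i, b j i ≠ 0 := by
  by_contra! h0
  have h1 := h.eval_eq j j
  rw [show b j = 0 from _root_.funext h0] at h1
  obtain ⟨a, ha⟩ := exists_eq_linForm (h.isHomogeneous j)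
  rw [ha, eval_linForm] at h1
  simp at h1

theorem IsFrame.aeval_l {b : Fin 3 → Fin 3 → ℂ} {l : Fin 3 → S} (h : IsFrame b l)
    (c : Fin 3 → Polynomial ℂ) (j : Fin 3) :
    aeval (fun i => ∑ k, Polynomial.C (b k i) * c k) (l j) = c j := by
  obtain ⟨a, ha⟩ := exists_eq_linForm (h.isHomogeneous j)
  have h1 : ∀ k, ∑ i, a i * b k i = if j = k then 1 else 0 := fun k => by
    rw [← h.eval_eq, ha, eval_linForm]
  rw [ha, aeval_linForm]
  simp_rw [Finset.mul_sum]
  rw [Finset.sum_comm]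
  have h2 : ∀ k, ∑ i, (algebraMap ℂ (Polynomial ℂ)) (a i) * (Polynomial.C (b k i) * c k) =
      Polynomial.C (if j = k then 1 else 0) * c k := by
    intro k
    rw [← h1 k, map_sum, Finset.sum_mul]
    refine Finset.sum_congr rfl fun i _ => ?_
    rw [map_mul, Polynomial.algebraMap_eq]
    ring
  rw [Finset.sum_congr rfl fun k _ => h2 k]
  simp

theorem isRelPrime_of_eval {P u : S} (hu : u.IsHomogeneous 1) (h0 : u ≠ 0) (y : Fin 3 → ℂ)
    (hy : eval y u = 0) (hP : eval y P ≠ 0) : IsRelPrime P u := by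
  have hp := (prime_of_isHomogeneous_one hu h0).irreducible
  refine ((Irreducible.isRelPrime_iff_not_dvd hp).mpr ?_).symm
  rintro ⟨q, rfl⟩
  simp [hy] at hP

/-- The affine parametrization `t ↦ b₁ + t b₀` of a line. -/
def lineParam (b : Fin 3 → Fin 3 → ℂ) (i : Fin 3) : Polynomial ℂ :=
  ∑ k, Polynomial.C (b k i) * ![Polynomial.X, 1, 0] k

theorem coeff_lineParam (b : Fin 3 → Fin 3 → ℂ) (i : Fin 3) : (lineParam b i).coeff 1 = b 0 i := by
  simp [lineParam, Fin.sum_univ_three]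

theorem IsFrame.isParam_line {b : Fin 3 → Fin 3 → ℂ} {l : Fin 3 → S} (h : IsFrame b l) {P : S}
    {κ : ℂ} (hκ : κ ≠ 0) (hP : P = C κ * l 2) : IsParam P 1 (lineParam b) := by
  have hco := coeff_lineParam b
  refine IsParam.mk_of_forms (u := l 1) (v := l 0) ?_ ?_ ?_ ?_ ?_ (h.isHomogeneous 1) le_rfl ?_ ?_ ?_
  · intro i
    simp only [lineParam, Fin.sum_univ_three]
    simp only [Matrix.cons_val_zero, Matrix.cons_val_one, Matrix.cons_val, mul_zero, add_zero,
      mul_one]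
    compute_degree
  · rw [hP, map_mul]
    have := h.aeval_l ![Polynomial.X, 1, 0] 2
    change _ * aeval (fun i => lineParam b i) (l 2) = 0
    unfold lineParam
    rw [this]
    simp
  · refine isRelPrime_of_eval (h.isHomogeneous 1) (h.l_ne_zero 1) (b 2) ?_ ?_
    · simp [h.eval_eq]
    · simp [hP, h.eval_eq, hκ]
  · exact h.aeval_l ![Polynomial.X, 1, 0] 1
  · exact h.aeval_l ![Polynomial.X, 1, 0] 0
  · intro i
    have : aeval ![l 0, l 1] ((lineParam b i).homogenize 1) = C (b 0 i) * l 0 + C (b 1 i) * l 1 := by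
      simp [lineParam, Fin.sum_univ_three]
    rw [this, h.X_eq i, Fin.sum_univ_three, hP]
    refine ⟨C (b 2 i * κ⁻¹), ?_⟩
    have hc : (C κ * C (b 2 i * κ⁻¹) : S) = C (b 2 i) := by
      rw [← C_mul]
      congr 1
      field_simp
    linear_combination (-l 2) * hc
  · simp_rw [hco]
    exact h.exists_ne_zero 0
  · intro y hy h1
    refine ⟨eval y (l 0), fun i => ?_⟩
    rw [hP, map_mul, eval_C] at hy
    have h2 := (mul_eq_zero.mp hy).resolve_left hκ
    rw [h.coord_eq y i, Fin.sum_univ_three, h1, h2, hco]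
    ring

/-- The affine parametrization `t ↦ b₂ + t b₁ + t² b₀` of a conic. -/
def conicParam (b : Fin 3 → Fin 3 → ℂ) (i : Fin 3) : Polynomial ℂ :=
  ∑ k, Polynomial.C (b k i) * ![Polynomial.X ^ 2, Polynomial.X, 1] k

theorem coeff_conicParam (b : Fin 3 → Fin 3 → ℂ) (i : Fin 3) :
    (conicParam b i).coeff 2 = b 0 i := by
  simp [conicParam, Fin.sum_univ_three]

theorem IsFrame.isParam_conic {b : Fin 3 → Fin 3 → ℂ} {l : Fin 3 → S} (h : IsFrame b l) {P : S}
    {κ : ℂ} (hκ : κ ≠ 0) (hP : P = C κ * (l 0 * l 2 - l 1 ^ 2)) : IsParam P 2 (conicParam b) := by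
  have hco := coeff_conicParam b
  have h0 : aeval (conicParam b) (l 0) = Polynomial.X ^ 2 :=
    h.aeval_l ![Polynomial.X ^ 2, Polynomial.X, 1] 0
  have h1 : aeval (conicParam b) (l 1) = Polynomial.X :=
    h.aeval_l ![Polynomial.X ^ 2, Polynomial.X, 1] 1
  have h2 : aeval (conicParam b) (l 2) = 1 :=
    h.aeval_l ![Polynomial.X ^ 2, Polynomial.X, 1] 2
  refine IsParam.mk_of_forms (u := l 2) (v := l 1) ?_ ?_ ?_ h2 h1 (h.isHomogeneous 2) one_le_two
    ?_ ?_ ?_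
  · intro i
    simp only [conicParam, Fin.sum_univ_three]
    simp only [Matrix.cons_val_zero, Matrix.cons_val_one, Matrix.cons_val, mul_one]
    compute_degree
  · rw [hP]
    simp [h0, h1, h2]
  · refine isRelPrime_of_eval (h.isHomogeneous 2) (h.l_ne_zero 2) (b 1) ?_ ?_
    · simp [h.eval_eq]
    · simp [hP, h.eval_eq, hκ]
  · intro i
    have : aeval ![l 1, l 2] ((conicParam b i).homogenize 2) =
        C (b 0 i) * l 1 ^ 2 + C (b 1 i) * (l 1 * l 2) + C (b 2 i) * l 2 ^ 2 := by
      simp [conicParam, Fin.sum_univ_three]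
    rw [this, h.X_eq i, Fin.sum_univ_three, hP]
    refine ⟨C (b 0 i * κ⁻¹), ?_⟩
    have hc : (C κ * C (b 0 i * κ⁻¹) : S) = C (b 0 i) := by
      rw [← C_mul]
      congr 1
      field_simp
    linear_combination (-(l 0 * l 2 - l 1 ^ 2)) * hc
  · simp_rw [hco]
    exact h.exists_ne_zero 0
  · intro y hy h1
    refine ⟨eval y (l 0), fun i => ?_⟩
    rw [hP, map_mul, eval_C] at hy
    have h2 := (mul_eq_zero.mp hy).resolve_left hκ
    have h3 : eval y (l 1) = 0 := by
      simpa [h1] using h2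
    rw [h.coord_eq y i, Fin.sum_univ_three, h1, h3, hco]
    ring

theorem IsFrame.eq_sum_of_isHomogeneous_one {b : Fin 3 → Fin 3 → ℂ} {l : Fin 3 → S}
    (h : IsFrame b l) {P : S} (hP : P.IsHomogeneous 1) : P = ∑ j, C (eval (b j) P) * l j := by
  obtain ⟨a, rfl⟩ := exists_eq_linForm hP
  apply MvPolynomial.funext
  intro y
  simp only [eval_linForm, map_sum, map_mul, eval_C]
  rw [Finset.sum_congr rfl fun i _ => by rw [h.coord_eq y i]]
  simp only [Finset.mul_sum, Finset.sum_mul]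
  rw [Finset.sum_comm]
  exact Finset.sum_congr rfl fun i _ => Finset.sum_congr rfl fun j _ => by ring

theorem exists_isFrame_line {P : S} (hP : P.IsHomogeneous 1) (h0 : P ≠ 0) {q : Fin 3 → ℂ}
    (hq : q ≠ 0) (hPq : eval q P = 0) :
    ∃ (b : Fin 3 → Fin 3 → ℂ) (l : Fin 3 → S) (κ : ℂ),
      IsFrame b l ∧ κ ≠ 0 ∧ P = C κ * l 2 ∧ b 0 = q := by
  obtain ⟨a, rfl⟩ := exists_eq_linForm hP
  have ha : a ≠ 0 := fun h => h0 ((linForm_eq_zero_iff a).mpr h)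
  let f : (Fin 3 → ℂ) →ₗ[ℂ] ℂ := Fintype.linearCombination ℂ a
  have hf : ∀ y, f y = eval y (linForm a) := fun y => by
    rw [eval_linForm, Fintype.linearCombination_apply]
    exact Finset.sum_congr rfl fun i _ => by rw [smul_eq_mul, mul_comm]
  obtain ⟨m, hm⟩ := Function.ne_iff.mp ha
  have hfr : f (Pi.single m 1) ≠ 0 := by
    simpa [hf, eval_linForm, Pi.single_apply] using hm
  have hfin : 1 < Module.finrank ℂ f.ker := by
    have h1 := f.finrank_range_add_finrank_ker
    have h2 : Module.finrank ℂ f.range ≤ 1 := by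
      simpa using Submodule.finrank_le f.range
    simp only [Module.finrank_fin_fun] at h1
    omega
  have hq' : q ∈ f.ker := by rw [LinearMap.mem_ker, hf, hPq]
  obtain ⟨⟨p, hp⟩, hpq⟩ := exists_linearIndependent_pair_of_one_lt_finrank hfin
    (x := ⟨q, hq'⟩) (by simpa [Subtype.ext_iff] using hq)
  rw [LinearIndependent.pair_iff] at hpq
  have hli : LinearIndependent ℂ ![q, p, Pi.single m 1] := by
    rw [Fintype.linearIndependent_iff]
    intro g hg
    rw [Fin.sum_univ_three] at hg
    simp only [Matrix.cons_val_zero, Matrix.cons_val_one, Matrix.cons_val] at hg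
    have h2 : g 2 = 0 := by
      have := congrArg f hg
      rw [map_add, map_add, map_smul, map_smul, map_smul, LinearMap.mem_ker.mp hq',
        LinearMap.mem_ker.mp hp] at this
      simpa [hfr] using this
    have h3 := hpq (g 0) (g 1) (by
      ext1
      simpa [h2] using hg)
    intro i
    fin_cases i
    · exact h3.1
    · exact h3.2
    · exact h2
  obtain ⟨l, hl⟩ := exists_isFrame hli
  refine ⟨_, l, f (Pi.single m 1), hl, hfr, ?_, rfl⟩
  rw [hl.eq_sum_of_isHomogeneous_one (linForm_isHomogeneous a), Fin.sum_univ_three]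
  simp only [← hf]
  simp [LinearMap.mem_ker.mp hq', LinearMap.mem_ker.mp hp]

theorem IsParam.exists_eval_ne_zero {P : S} {e : ℕ} {φ : Fin 3 → Polynomial ℂ}
    (h : IsParam P e φ) {ι : Type*} (s : Finset ι) (Z : ι → S) (d : ι → ℕ)
    (hZ : ∀ j, (Z j).IsHomogeneous (d j)) (hPZ : ∀ j ∈ s, ¬ P ∣ Z j) :
    ∃ t : ℂ, ∀ j ∈ s, eval (fun i => (φ i).eval t) (Z j) ≠ 0 := by
  have h0 : ∏ j ∈ s, aeval φ (Z j) ≠ 0 := Finset.prod_ne_zero_iff.mpr fun j hj h1 =>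
    hPZ j hj (h.dvd_of_aeval_eq_zero _ _ (hZ j) h1)
  obtain ⟨t, ht⟩ := Polynomial.exists_eval_ne_zero_of_natDegree_lt_card _ h0
    (by simpa using Cardinal.natCast_lt_aleph0.trans_le (Cardinal.aleph0_le_mk ℂ))
  refine ⟨t, fun j hj h1 => ht ?_⟩
  rw [Polynomial.eval_prod]
  exact Finset.prod_eq_zero hj (by rw [eval_aeval_polynomial, h1])

theorem IsParam.ne_zero {P : S} {e : ℕ} {φ : Fin 3 → Polynomial ℂ} (h : IsParam P e φ) (t : ℂ) :
    (fun i => (φ i).eval t) ≠ 0 := by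
  intro h0
  have := h.injective t (t + 1) 0 (fun i => by rw [zero_mul]; exact congrFun h0 i)
  simp at this

theorem exists_ne_zero_eval_eq_zero {P : S} (hP : P.IsHomogeneous 1) :
    ∃ q : Fin 3 → ℂ, q ≠ 0 ∧ eval q P = 0 := by
  obtain ⟨a, rfl⟩ := exists_eq_linForm hP
  by_cases h : a 0 = 0
  · exact ⟨Pi.single 0 1, by simp, by simp [eval_linForm, Pi.single_apply, h]⟩
  · refine ⟨![-a 1, a 0, 0], fun h' => h (by simpa using congrFun h' 1), ?_⟩
    simp [eval_linForm, Fin.sum_univ_three]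
    ring

theorem exists_isParam_line {P : S} (hP : P.IsHomogeneous 1) (h0 : P ≠ 0) {ι : Type*}
    (s : Finset ι) (Z : ι → S) (d : ι → ℕ)
    (hZ : ∀ j, (Z j).IsHomogeneous (d j)) (hPZ : ∀ j ∈ s, ¬ P ∣ Z j) :
    ∃ φ, IsParam P 1 φ ∧ ∀ j ∈ s, eval (fun i => (φ i).coeff 1) (Z j) ≠ 0 := by
  obtain ⟨q₀, hq₀, hPq₀⟩ := exists_ne_zero_eval_eq_zero hP
  obtain ⟨b, l, κ, hbl, hκ, hPl, -⟩ := exists_isFrame_line hP h0 hq₀ hPq₀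
  have hφ := hbl.isParam_line hκ hPl
  obtain ⟨t, ht⟩ := hφ.exists_eval_ne_zero s Z d hZ hPZ
  -- The point found off the other curves becomes `b' 0`, the point at infinity of the new
  -- parametrization.
  obtain ⟨b', l', κ', hbl', hκ', hPl', hq⟩ := exists_isFrame_line hP h0 (hφ.ne_zero t)
    (by rw [← eval_aeval_polynomial, hφ.aeval_eq_zero, Polynomial.eval_zero])
  refine ⟨_, hbl'.isParam_line hκ' hPl', ?_⟩
  have : (fun i => (lineParam b' i).coeff 1) = b' 0 := by
    funext i
    exact coeff_lineParam b' i
  rw [this, hq]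
  exact ht

theorem pderiv_comm (i j : Fin 3) (G : S) : pderiv i (pderiv j G) = pderiv j (pderiv i G) := by
  have h : ⁅(pderiv i : Derivation ℂ S S), (pderiv j : Derivation ℂ S S)⁆ = 0 := by
    refine derivation_ext fun k => ?_
    rw [Derivation.commutator_apply, pderiv_X, pderiv_X]
    by_cases h1 : j = k <;> by_cases h2 : i = k <;> simp [h1, h2]
  have h1 := DFunLike.congr_fun h G
  rw [Derivation.commutator_apply] at h1
  exact sub_eq_zero.mp h1

/-- A smooth conic is `xz - y²` in suitable coordinates. -/
theorem exists_isFrame_conic {P : S} (hP : P.IsHomogeneous 2)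
    (hsm : ∀ v : Fin 3 → ℂ, v ≠ 0 → ¬ IsSingularAt P v) :
    ∃ (b : Fin 3 → Fin 3 → ℂ) (l : Fin 3 → S), IsFrame b l ∧ P = C 1 * (l 0 * l 2 - l 1 ^ 2) := by
  have hd : ∀ i, (pderiv i P).IsHomogeneous 1 := fun i => hP.pderiv
  choose M hM using fun i => exists_eq_linForm (hd i)
  have hsymm : ∀ i j, M i j = M j i := by
    intro i j
    have h1 : pderiv j (pderiv i P) = pderiv i (pderiv j P) := pderiv_comm j i P
    rw [hM i, hM j, pderiv_linForm, pderiv_linForm] at h1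
    exact C_injective _ _ h1
  have hev : ∀ v, 2 * eval v P = ∑ i, ∑ j, v i * M i j * v j := by
    intro v
    have h1 := congrArg (eval v) hP.sum_X_mul_pderiv
    simp only [map_sum, map_mul, eval_X, hM, eval_linForm, Finset.mul_sum] at h1
    rw [nsmul_eq_mul, map_mul, map_natCast, Nat.cast_ofNat] at h1
    rw [← h1]
    exact Finset.sum_congr rfl fun i _ => Finset.sum_congr rfl fun j _ => by ring
  let B : (Fin 3 → ℂ) →ₗ[ℂ] (Fin 3 → ℂ) →ₗ[ℂ] ℂ := Matrix.toLinearMap₂' ℂ (Matrix.of fun i j => M i j / 2)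
  have hB : ∀ v w, B v w = (∑ i, ∑ j, v i * M i j * w j) / 2 := by
    intro v w
    rw [Matrix.toLinearMap₂'_apply, Finset.sum_div]
    refine Finset.sum_congr rfl fun i _ => ?_
    rw [Finset.sum_div]
    refine Finset.sum_congr rfl fun j _ => ?_
    simp only [smul_eq_mul, Matrix.of_apply]
    ring
  let Q : QuadraticForm ℂ (Fin 3 → ℂ) := LinearMap.BilinMap.toQuadraticMap B
  have hQ : ∀ v, Q v = eval v P := by
    intro v
    change B v v = _
    rw [hB, ← hev]
    ring
  have hBsymm : ∀ v w, B v w = B w v := by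
    intro v w
    rw [hB, hB, Finset.sum_comm]
    congr 1
    exact Finset.sum_congr rfl fun i _ => Finset.sum_congr rfl fun j _ => by rw [hsymm]; ring
  have hassoc : QuadraticMap.associated Q = B :=
    QuadraticMap.associated_left_inverse ℂ hBsymm
  -- A nonzero vector in the radical of the polar form would be a singular point of the conic.
  have hsep : LinearMap.SeparatingLeft (QuadraticMap.associated Q) := by
    rw [hassoc]
    intro v hv
    by_contra hv0
    refine hsm v hv0 ⟨?_, ?_⟩
    · rw [← hQ]
      exact hv v
    · intro i
      have h1 := hv (Pi.single i 1)
      rw [hB] at h1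
      rw [hM, eval_linForm]
      simp only [Pi.single_apply, mul_ite, mul_one, mul_zero, Finset.sum_ite_eq',
        Finset.mem_univ, if_true, div_eq_zero_iff] at h1
      rw [← h1.resolve_right two_ne_zero]
      exact Finset.sum_congr rfl fun j _ => by rw [hsymm]; ring
  obtain ⟨n, hn, ⟨E⟩⟩ : ∃ n, n = 3 ∧ Nonempty
      (QuadraticMap.IsometryEquiv Q (QuadraticMap.weightedSumSquares ℂ (1 : Fin n → ℂ))) :=
    ⟨_, Module.finrank_fin_fun ℂ,
      QuadraticForm.equivalent_weightedSumSquares_of_isAlgClosed Q hsep⟩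
  subst hn
  have hE : ∀ v, eval v P = E v 0 ^ 2 + E v 1 ^ 2 + E v 2 ^ 2 := by
    intro v
    rw [← hQ, ← E.map_app v, QuadraticMap.weightedSumSquares_apply, Fin.sum_univ_three]
    simp [sq]
  have hlin : ∀ (v : Fin 3 → ℂ) (j : Fin 3), E v j = eval v (linForm fun i => E (Pi.single i 1) j) := by
    intro v j
    rw [eval_linForm]
    have h1 : v = ∑ i, v i • (Pi.single i 1 : Fin 3 → ℂ) := (pi_eq_sum_univ' v)
    have h2 : E v = ∑ i, v i • E (Pi.single i 1) := by
      conv_lhs => rw [h1]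
      exact (map_sum E.toLinearEquiv _ _).trans (Finset.sum_congr rfl fun i _ =>
        map_smul E.toLinearEquiv _ _)
    rw [h2, Finset.sum_apply]
    exact Finset.sum_congr rfl fun i _ => by rw [Pi.smul_apply, smul_eq_mul, mul_comm]
  let w : Fin 3 → S := fun j => linForm fun i => E (Pi.single i 1) j
  have hw : ∀ v j, eval v (w j) = E v j := fun v j => (hlin v j).symm
  have hw1 : ∀ j, (w j).IsHomogeneous 1 := fun j => linForm_isHomogeneous _
  have hI : Complex.I * Complex.I = -1 := Complex.I_mul_I
  -- A sum of squares `x² + y² + z²` equals `(x + iy)(x - iy) - (iz)²`; `c` is the basis dual to `x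
  -- + iy`, `iz`, `x - iy`.
  let c : Fin 3 → Fin 3 → ℂ := ![![1 / 2, -Complex.I / 2, 0], ![0, 0, -Complex.I],
    ![1 / 2, Complex.I / 2, 0]]
  let b : Fin 3 → Fin 3 → ℂ := fun j => E.toLinearEquiv.symm (c j)
  have hb : ∀ j, E (b j) = c j := fun j => E.toLinearEquiv.apply_symm_apply (c j)
  refine ⟨b, ![w 0 + C Complex.I * w 1, C Complex.I * w 2, w 0 - C Complex.I * w 1],
    ⟨?_, ?_, ?_⟩, ?_⟩
  · intro j
    fin_cases j
    · exact (hw1 0).add ((hw1 1).C_mul _)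
    · exact (hw1 2).C_mul _
    · exact (hw1 0).sub ((hw1 1).C_mul _)
  · intro i
    apply MvPolynomial.funext
    intro v
    have h1 : v = ∑ j, (![E v 0 + Complex.I * E v 1, Complex.I * E v 2,
        E v 0 - Complex.I * E v 1] j) • b j := by
      apply E.toLinearEquiv.injective
      rw [map_sum]
      change E v = _
      funext m
      rw [Fin.sum_univ_three]
      simp only [map_smul]
      have h2 : ∀ j, E.toLinearEquiv (b j) = c j := hb
      rw [h2, h2, h2]
      fin_cases m
      · simp [c]
        ring
      · simp [c]
        linear_combination E v 1 * hI
      · simp [c]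
        linear_combination E v 2 * hI
    have h3 := congrFun h1 i
    rw [Fin.sum_univ_three] at h3 ⊢
    simp only [eval_X, map_add, map_mul, eval_C, Matrix.cons_val_zero, Matrix.cons_val_one,
      Matrix.cons_val, hw, map_sub]
    rw [h3]
    simp
    ring
  · intro j k
    fin_cases j <;> fin_cases k <;> simp [hw, hb, c] <;>
      first | linear_combination (-1 / 2) * hI | linear_combination (1 / 2) * hI
  · apply MvPolynomial.funext
    intro v
    simp [hw, hE]
    linear_combination (E v 1 ^ 2 + E v 2 ^ 2) * hI

theorem exists_isParam_conic {P : S} (hP : P.IsHomogeneous 2)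
    (hsm : ∀ v : Fin 3 → ℂ, v ≠ 0 → ¬ IsSingularAt P v) {ι : Type*}
    (s : Finset ι) (Z : ι → S) (d : ι → ℕ)
    (hZ : ∀ j, (Z j).IsHomogeneous (d j)) (hPZ : ∀ j ∈ s, ¬ P ∣ Z j) :
    ∃ φ, IsParam P 2 φ ∧ ∀ j ∈ s, eval (fun i => (φ i).coeff 2) (Z j) ≠ 0 := by
  obtain ⟨b, l, hbl, hPl⟩ := exists_isFrame_conic hP hsm
  have hφ := hbl.isParam_conic one_ne_zero hPl
  obtain ⟨t, ht⟩ := hφ.exists_eval_ne_zero s Z d hZ hPZ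
  -- Substitute `t + 1/s` for the parameter and clear `s²`: the coefficient of `s²`, which is the
  -- new point at infinity, is the old point with parameter `t`.
  let b' : Fin 3 → Fin 3 → ℂ := ![fun i => t ^ 2 * b 0 i + t * b 1 i + b 2 i,
    fun i => 2 * t * b 0 i + b 1 i, b 0]
  let l' : Fin 3 → S := ![l 2, l 1 - C t * l 2, l 0 - C (2 * t) * l 1 + C (t ^ 2) * l 2]
  have hl' : ∀ j, (l' j).IsHomogeneous 1 := by
    intro j
    fin_cases j
    · exact hbl.isHomogeneous 2
    · exact (hbl.isHomogeneous 1).sub ((hbl.isHomogeneous 2).C_mul _)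
    · exact ((hbl.isHomogeneous 0).sub ((hbl.isHomogeneous 1).C_mul _)).add
        ((hbl.isHomogeneous 2).C_mul _)
  have hlin : ∀ j, ∃ a, l j = linForm a := fun j => exists_eq_linForm (hbl.isHomogeneous j)
  have hev : ∀ j (x y z : ℂ), eval (fun i => x * b 0 i + y * b 1 i + z * b 2 i) (l j) =
      x * eval (b 0) (l j) + y * eval (b 1) (l j) + z * eval (b 2) (l j) := by
    intro j x y z
    obtain ⟨a, ha⟩ := hlin j
    rw [ha]
    simp only [eval_linForm, Fin.sum_univ_three]
    ring
  have e0 : ∀ j, eval (fun i => t ^ 2 * b 0 i + t * b 1 i + b 2 i) (l j) =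
      t ^ 2 * eval (b 0) (l j) + t * eval (b 1) (l j) + eval (b 2) (l j) := by
    intro j
    simpa using hev j (t ^ 2) t 1
  have e1 : ∀ j, eval (fun i => 2 * t * b 0 i + b 1 i) (l j) =
      2 * t * eval (b 0) (l j) + eval (b 1) (l j) := by
    intro j
    simpa using hev j (2 * t) 1 0
  have hbl' : IsFrame b' l' := by
    refine ⟨hl', ?_, ?_⟩
    · intro i
      rw [hbl.X_eq i, Fin.sum_univ_three, Fin.sum_univ_three]
      simp only [b', l', Matrix.cons_val_zero, Matrix.cons_val_one, Matrix.cons_val, map_add,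
        map_mul, map_pow]
      rw [show (C 2 : S) = 2 from map_ofNat C 2]
      ring
    · intro j k
      fin_cases j <;> fin_cases k <;> simp [b', l', e0, e1, hbl.eval_eq]
      ring
  have hPl' : P = C 1 * (l' 0 * l' 2 - l' 1 ^ 2) := by
    rw [hPl]
    simp only [l', Matrix.cons_val_zero, Matrix.cons_val_one, Matrix.cons_val, map_mul, map_pow,
      map_one]
    rw [show (C 2 : S) = 2 from map_ofNat C 2]
    ring
  refine ⟨_, hbl'.isParam_conic one_ne_zero hPl', ?_⟩
  have : (fun i => (conicParam b' i).coeff 2) = fun i => (conicParam b i).eval t := by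
    funext i
    rw [coeff_conicParam]
    simp [conicParam, Fin.sum_univ_three, b']
    ring
  rw [this]
  exact ht

/-! ### Multiplicities at nodes, tacnodes and ordinary triple points -/

/-- The coefficient of `xⁱ yʲ`. -/
def co (i j : ℕ) (p : R) : ℂ :=
  MvPowerSeries.coeff (Finsupp.single 0 i + Finsupp.single 1 j) p

theorem co_add (i j : ℕ) (p q : R) : co i j (p + q) = co i j p + co i j q := map_add _ _ _

theorem co_sub (i j : ℕ) (p q : R) : co i j (p - q) = co i j p - co i j q := map_sub _ _ _

theorem co_zero_zero (p : R) : co 0 0 p = MvPowerSeries.constantCoeff p := by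
  simp [co]

theorem co_mul (i j : ℕ) (p q : R) :
    co i j (p * q) = ∑ a ∈ Finset.HasAntidiagonal.antidiagonal i, ∑ b ∈ Finset.HasAntidiagonal.antidiagonal j,
      co a.1 b.1 p * co a.2 b.2 q := by
  classical
  rw [co, MvPowerSeries.coeff_mul, ← Finset.sum_product']
  refine Finset.sum_nbij' (fun x => ((x.1 0, x.2 0), (x.1 1, x.2 1)))
    (fun y => (Finsupp.single 0 y.1.1 + Finsupp.single 1 y.2.1,
      Finsupp.single 0 y.1.2 + Finsupp.single 1 y.2.2)) ?_ ?_ ?_ ?_ ?_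
  · rintro ⟨a, b⟩ h
    simp only [Finset.HasAntidiagonal.mem_antidiagonal] at h
    simp only [Finset.mem_product, Finset.HasAntidiagonal.mem_antidiagonal]
    constructor
    · simpa using DFunLike.congr_fun h 0
    · simpa using DFunLike.congr_fun h 1
  · rintro ⟨⟨a, b⟩, ⟨c, d⟩⟩ h
    simp only [Finset.mem_product, Finset.HasAntidiagonal.mem_antidiagonal] at h
    simp only [Finset.HasAntidiagonal.mem_antidiagonal]
    ext k
    fin_cases k
    · simpa using h.1
    · simpa using h.2
  · rintro ⟨a, b⟩ _
    ext k <;> fin_cases k <;> simp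
  · rintro ⟨⟨a, b⟩, ⟨c, d⟩⟩ _
    simp
  · rintro ⟨a, b⟩ _
    simp only [co]
    congr 2 <;> (congr 1; ext k; fin_cases k <;> simp)

theorem co_mul_eq_zero {n : ℕ} {v p : R} (hv : co 0 0 v = 0)
    (hp : ∀ i j, i + j < n → co i j p = 0) : ∀ i j, i + j < n + 1 → co i j (v * p) = 0 := by
  intro i j hij
  rw [co_mul]
  refine Finset.sum_eq_zero fun a ha => Finset.sum_eq_zero fun b hb => ?_
  rw [Finset.HasAntidiagonal.mem_antidiagonal] at ha hb
  by_cases h : a.1 = 0 ∧ b.1 = 0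
  · rw [h.1, h.2, hv, zero_mul]
  · rw [hp a.2 b.2 (by omega), mul_zero]

theorem co_X_zero (i j : ℕ) : co i j (MvPowerSeries.X 0) = if i = 1 ∧ j = 0 then 1 else 0 := by
  classical
  rw [co, MvPowerSeries.coeff_X]
  refine if_congr ?_ rfl rfl
  rw [DFunLike.ext_iff, Fin.forall_fin_two]
  simp

theorem co_X_one (i j : ℕ) : co i j (MvPowerSeries.X 1) = if i = 0 ∧ j = 1 then 1 else 0 := by
  classical
  rw [co, MvPowerSeries.coeff_X]
  refine if_congr ?_ rfl rfl
  rw [DFunLike.ext_iff, Fin.forall_fin_two]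
  simp

theorem co_pow_three_mul {ν h : R} (hν : co 0 0 ν = 0) {i j : ℕ} (hij : i + j < 3) :
    co i j (ν ^ 3 * h) = 0 := by
  have h1 := co_mul_eq_zero (n := 0) (p := h) hν (by simp)
  have h2 := co_mul_eq_zero hν h1
  have h3 := co_mul_eq_zero hν h2
  rw [show ν ^ 3 * h = ν * (ν * (ν * h)) by ring]
  exact h3 i j hij

theorem antidiagonal_small :
    Finset.HasAntidiagonal.antidiagonal 0 = {((0 : ℕ), (0 : ℕ))} ∧
    Finset.HasAntidiagonal.antidiagonal 1 = {((0 : ℕ), (1 : ℕ)), (1, 0)} ∧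
    Finset.HasAntidiagonal.antidiagonal 2 = {((0 : ℕ), (2 : ℕ)), (1, 1), (2, 0)} ∧
    Finset.HasAntidiagonal.antidiagonal 3 = {((0 : ℕ), (3 : ℕ)), (1, 2), (2, 1), (3, 0)} ∧
    Finset.HasAntidiagonal.antidiagonal 4 =
      {((0 : ℕ), (4 : ℕ)), (1, 3), (2, 2), (3, 1), (4, 0)} := by
  decide

/-- The low order coefficients of `ξ² a + ξ b` where `ξ ∈ 𝔪` and `b ∈ 𝔪³`. -/
theorem co_sq_mul_add {ξ ν a h : R} (hξ : co 0 0 ξ = 0) (hν : co 0 0 ν = 0) :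
    co 2 0 (ξ * (ξ * a + ν ^ 3 * h)) = co 1 0 ξ ^ 2 * co 0 0 a ∧
    co 1 1 (ξ * (ξ * a + ν ^ 3 * h)) = 2 * co 1 0 ξ * co 0 1 ξ * co 0 0 a ∧
    co 0 2 (ξ * (ξ * a + ν ^ 3 * h)) = co 0 1 ξ ^ 2 * co 0 0 a ∧
    co 3 0 (ξ * (ξ * a + ν ^ 3 * h)) =
      co 1 0 ξ ^ 2 * co 1 0 a + 2 * co 1 0 ξ * co 2 0 ξ * co 0 0 a ∧
    co 2 1 (ξ * (ξ * a + ν ^ 3 * h)) = co 1 0 ξ ^ 2 * co 0 1 a + 2 * co 1 0 ξ * co 0 1 ξ * co 1 0 a +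
      2 * co 1 0 ξ * co 1 1 ξ * co 0 0 a + 2 * co 0 1 ξ * co 2 0 ξ * co 0 0 a ∧
    co 1 2 (ξ * (ξ * a + ν ^ 3 * h)) = co 0 1 ξ ^ 2 * co 1 0 a + 2 * co 1 0 ξ * co 0 1 ξ * co 0 1 a +
      2 * co 0 1 ξ * co 1 1 ξ * co 0 0 a + 2 * co 1 0 ξ * co 0 2 ξ * co 0 0 a ∧
    co 0 3 (ξ * (ξ * a + ν ^ 3 * h)) =
      co 0 1 ξ ^ 2 * co 0 1 a + 2 * co 0 1 ξ * co 0 2 ξ * co 0 0 a ∧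
    (co 1 0 ξ = 0 → co 4 0 (ξ * (ξ * a + ν ^ 3 * h)) = co 2 0 ξ ^ 2 * co 0 0 a) := by
  obtain ⟨a0, a1, a2, a3, a4⟩ := antidiagonal_small
  have hb : ∀ i j, i + j < 3 → co i j (ν ^ 3 * h) = 0 := fun i j => co_pow_three_mul hν
  generalize ν ^ 3 * h = b at hb ⊢
  have b00 := hb 0 0 (by norm_num)
  have b10 := hb 1 0 (by norm_num)
  have b01 := hb 0 1 (by norm_num)
  have b20 := hb 2 0 (by norm_num)
  have b11 := hb 1 1 (by norm_num)
  have b02 := hb 0 2 (by norm_num)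
  refine ⟨?_, ?_, ?_, ?_, ?_, ?_, ?_, fun h10 => ?_⟩
  all_goals
    simp [co_mul, co_add, a0, a1, a2, a3, a4, hξ, b00, b10, b01, b20, b11, b02]
  all_goals try simp only [h10]
  all_goals ring

/-- The quadratic part on the left is a constant times the square of a linear form, and `xy` is not.
-/
theorem ne_node {ξ ν a h : R} (hξ : co 0 0 ξ = 0) (hν : co 0 0 ν = 0) :
    ξ * (ξ * a + ν ^ 3 * h) ≠ MvPowerSeries.X 0 * MvPowerSeries.X 1 := by
  intro heq
  obtain ⟨h20, h11, h02, -⟩ := co_sq_mul_add (a := a) (h := h) hξ hν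
  obtain ⟨a0, a1, a2, a3, a4⟩ := antidiagonal_small
  rw [heq] at h20 h11 h02
  simp [co_mul, co_X_zero, co_X_one, a0, a1, a2] at h20 h11 h02
  grind

/-- The quadratic part `y²` forces the linear part of `ξ` to be a multiple of `y` and `a` to be a
unit. The `x²y` term then needs an `x²` term in `ξ`, which would produce a nonzero `x⁴` term. -/
theorem ne_tacnode {ξ ν a h : R} (hξ : co 0 0 ξ = 0) (hν : co 0 0 ν = 0) :
    ξ * (ξ * a + ν ^ 3 * h) ≠
      MvPowerSeries.X 1 * (MvPowerSeries.X 1 - MvPowerSeries.X 0 ^ 2) := by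
  intro heq
  obtain ⟨h20, h11, h02, h30, h21, h12, h03, h40⟩ := co_sq_mul_add (a := a) (h := h) hξ hν
  obtain ⟨a0, a1, a2, a3, a4⟩ := antidiagonal_small
  rw [heq] at h20 h02 h21 h40
  simp [co_mul, co_sub, sq (MvPowerSeries.X 0 : R), co_X_zero, co_X_one, a0, a1, a2, a4] at h20 h02 h21 h40
  grind

/-- The quadratic part must vanish. If `a` is a unit, then `ξ` has no linear part and the cubic part
vanishes; otherwise the cubic part is a linear form times the square of another, whereas `xy(x + y)`
is squarefree. -/
theorem ne_triple {ξ ν a h : R} (hξ : co 0 0 ξ = 0) (hν : co 0 0 ν = 0) :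
    ξ * (ξ * a + ν ^ 3 * h) ≠
      MvPowerSeries.X 0 * MvPowerSeries.X 1 * (MvPowerSeries.X 0 + MvPowerSeries.X 1) := by
  intro heq
  obtain ⟨h20, h11, h02, h30, h21, h12, h03, -⟩ := co_sq_mul_add (a := a) (h := h) hξ hν
  obtain ⟨a0, a1, a2, a3, a4⟩ := antidiagonal_small
  rw [heq] at h20 h02 h30 h21 h12 h03
  simp [co_mul, co_add, co_X_zero, co_X_one, a0, a1, a2, a3] at h20 h02 h30 h21 h12 h03
  clear heq h11 a0 a1 a2 a3 a4
  by_cases ha : co 0 0 a = 0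
  · simp only [ha, mul_zero, add_zero] at h30 h21 h12 h03
    have h10 : co 1 0 ξ ≠ 0 := by
      intro h0
      simp [h0] at h21
    have h01 : co 0 1 ξ ≠ 0 := by
      intro h0
      simp [h0] at h12
    have ha1 := (mul_eq_zero.mp h30.symm).resolve_left (pow_ne_zero 2 h10)
    have ha2 := (mul_eq_zero.mp h03.symm).resolve_left (pow_ne_zero 2 h01)
    simp [ha1, ha2] at h21
  · simp [h20.resolve_right ha, h02.resolve_right ha] at h21

theorem constantCoeff_localEquation (f : S) (v w₁ w₂ : Fin 3 → ℂ) :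
    MvPowerSeries.constantCoeff (localEquation f v w₁ w₂) = eval v f := by
  rw [localEquation, MvPolynomial.map_aeval, MvPolynomial.eval]
  apply congrArg (fun F : S →+* ℂ => F f)
  ext
  · simp [MvPowerSeries.algebraMap_apply]
  · simp

/-- An automorphism preserves non-units, hence the maximal ideal; no continuity has to be assumed.
-/
theorem co_algEquiv_eq_zero (ψ : R ≃ₐ[ℂ] R) {p : R} (hp : co 0 0 p = 0) : co 0 0 (ψ p) = 0 := by
  by_contra h
  have h1 : IsUnit (ψ p) := by
    rw [MvPowerSeries.isUnit_iff_constantCoeff, ← co_zero_zero]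
    exact isUnit_iff_ne_zero.mpr h
  have h2 := h1.map ψ.symm
  rw [ψ.symm_apply_apply, MvPowerSeries.isUnit_iff_constantCoeff, ← co_zero_zero, hp] at h2
  exact not_isUnit_zero h2

/-- If a curve has only nodes, tacnodes and ordinary triple points, then the intersection
multiplicity of a rational component with the union of the other ones is at most two. -/
theorem rootMultiplicity_le_two {f P g : S} {e d : ℕ} {φ : Fin 3 → Polynomial ℂ}
    (hf : OnlyNodesTacnodesTriplePoints f) (hfg : f = P * g) (hφ : IsParam P e φ)
    (hg : g.IsHomogeneous d) (hg0 : aeval φ g ≠ 0) (t : ℂ) :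
    (aeval φ g).rootMultiplicity t ≤ 2 := by
  by_contra! h3
  have hdvd : (Polynomial.X - Polynomial.C t) ^ 3 ∣ aeval φ g :=
    (Polynomial.le_rootMultiplicity_iff hg0).mp h3
  obtain ⟨u, v, hu, hv, huv⟩ := hφ.exists_local t
  obtain ⟨N, h, q, hq⟩ := huv g d 3 hg hdvd
  set p : Fin 3 → ℂ := fun i => (φ i).eval t with hp
  have hPp : eval p P = 0 := by
    rw [hp, ← eval_aeval_polynomial, hφ.aeval_eq_zero, Polynomial.eval_zero]
  have hgp : eval p g = 0 := by
    rw [hp, ← eval_aeval_polynomial]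
    obtain ⟨r, hr⟩ := hdvd
    rw [hr]
    simp
  have hsing : IsSingularAt f p := by
    refine ⟨by rw [hfg, map_mul, hPp, zero_mul], fun i => ?_⟩
    rw [hfg, Derivation.leibniz, smul_eq_mul, smul_eq_mul, map_add, map_mul, map_mul, hPp, hgp]
    ring
  -- Contact of order at least three gives `u ^ N * g = P * q + v ^ 3 * h`. Since `u` is a unit at
  -- `p`, the local equation of `P * g` has the shape `ξ (ξ a + ν³ h)` excluded by the three
  -- preceding coefficient computations.
  have key : ∀ G : R, (∀ ξ ν a h : R, co 0 0 ξ = 0 → co 0 0 ν = 0 → ξ * (ξ * a + ν ^ 3 * h) ≠ G) →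
      ¬ HasLocalType f p G := by
    rintro G hG ⟨w₁, w₂, -, ψ, c, hc⟩
    have hmul : ∀ a b, localEquation (a * b) p w₁ w₂ =
        localEquation a p w₁ w₂ * localEquation b p w₁ w₂ := fun a b => map_mul _ _ _
    have hpow : ∀ a n, localEquation (a ^ n) p w₁ w₂ = localEquation a p w₁ w₂ ^ n :=
      fun a n => map_pow _ _ _
    have hadd : ∀ a b, localEquation (a + b) p w₁ w₂ =
        localEquation a p w₁ w₂ + localEquation b p w₁ w₂ := fun a b => map_add _ _ _
    have hco : ∀ a, co 0 0 (localEquation a p w₁ w₂) = eval p a := fun a => by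
      rw [co_zero_zero, constantCoeff_localEquation]
    have hU : IsUnit (localEquation u p w₁ w₂ ^ N) := by
      apply IsUnit.pow
      rw [MvPowerSeries.isUnit_iff_constantCoeff, constantCoeff_localEquation, hu]
      exact isUnit_one
    obtain ⟨U, hU⟩ := hU.exists_right_inv
    have hrel : localEquation u p w₁ w₂ ^ N * localEquation g p w₁ w₂ =
        localEquation P p w₁ w₂ * localEquation q p w₁ w₂ +
          localEquation v p w₁ w₂ ^ 3 * localEquation h p w₁ w₂ := by
      rw [← hpow, ← hpow, ← hmul, ← hmul, ← hmul, ← hadd]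
      congr 1
      linear_combination hq
    have hgl : localEquation g p w₁ w₂ = localEquation P p w₁ w₂ * (localEquation q p w₁ w₂ * U) +
          localEquation v p w₁ w₂ ^ 3 * (localEquation h p w₁ w₂ * U) := by
      linear_combination (-localEquation g p w₁ w₂) * hU + U * hrel
    refine hG (ψ (localEquation P p w₁ w₂)) (ψ (localEquation v p w₁ w₂))
      (ψ (localEquation q p w₁ w₂ * U) * c) (ψ (localEquation h p w₁ w₂ * U) * c)
      (co_algEquiv_eq_zero ψ (by rw [hco, hPp])) (co_algEquiv_eq_zero ψ (by rw [hco, hv])) ?_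
    rw [← hc, hfg, hmul, hgl]
    simp only [map_mul, map_add, map_pow]
    ring
  rcases hf p (hφ.ne_zero t) hsing with h | h | h
  · exact key _ (fun _ _ _ _ => ne_node) h
  · exact key _ (fun _ _ _ _ => ne_tacnode) h
  · exact key _ (fun _ _ _ _ => ne_triple) h

/-! ### Forms with prescribed invariant curves -/

theorem finrank_le_add_of_map {V W : Type*} [AddCommGroup V] [Module ℂ V] [AddCommGroup W]
    [Module ℂ W] (D : Submodule ℂ V) [FiniteDimensional ℂ D] (T : V →ₗ[ℂ] W) (A : Submodule ℂ W)
    [FiniteDimensional ℂ A] (B : Submodule ℂ V) [FiniteDimensional ℂ B]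
    (hA : ∀ x ∈ D, T x ∈ A) (hB : ∀ x ∈ D, T x = 0 → x ∈ B) :
    Module.finrank ℂ D ≤ Module.finrank ℂ A + Module.finrank ℂ B := by
  rw [← (T.domRestrict D).finrank_range_add_finrank_ker]
  apply add_le_add
  · apply Submodule.finrank_mono
    rintro _ ⟨x, rfl⟩
    exact hA x x.2
  · rw [(Submodule.equivMapOfInjective D.subtype D.injective_subtype _).finrank_eq]
    apply Submodule.finrank_mono
    rintro _ ⟨x, hx, rfl⟩
    exact hB x x.2 hx

/-- Homogeneous `1`-forms `ω` of degree `s` on the plane for which the curves `Z j = 0`,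
`j ∈ Y`, are invariant. -/
def logForms {ι : Type*} (Z : ι → S) (Y : Finset ι) (s : ℕ) : Submodule ℂ (Fin 3 → S) where
  -- The sum is the contraction of `ω` with the Euler field; the last condition says that `Z j`
  -- divides all coefficients of `dZ j ∧ ω`.
  carrier := {ω | (∀ i, (ω i).IsHomogeneous s) ∧ ∑ i, X i * ω i = 0 ∧
    ∀ j ∈ Y, ∀ a b, Z j ∣ pderiv a (Z j) * ω b - pderiv b (Z j) * ω a}
  zero_mem' := ⟨fun i => isHomogeneous_zero _ _ _, by simp, by simp⟩
  add_mem' := by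
    rintro ω η ⟨h1, h2, h3⟩ ⟨k1, k2, k3⟩
    refine ⟨fun i => (h1 i).add (k1 i), ?_, fun j hj a b => ?_⟩
    · simp [mul_add, Finset.sum_add_distrib, h2, k2]
    · convert dvd_add (h3 j hj a b) (k3 j hj a b) using 1
      simp only [Pi.add_apply]
      ring
  smul_mem' := by
    rintro c ω ⟨h1, h2, h3⟩
    refine ⟨fun i => ?_, ?_, fun j hj a b => ?_⟩
    · rw [Pi.smul_apply, smul_eq_C_mul]
      exact (h1 i).C_mul c
    · simp [← Finset.smul_sum, h2]
    · convert (h3 j hj a b).mul_left (C c) using 1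
      simp only [Pi.smul_apply, smul_eq_C_mul]
      ring

/-- Triples of homogeneous polynomials of degree `s`. -/
def homTriples (s : ℕ) : Submodule ℂ (Fin 3 → S) :=
  Submodule.pi Set.univ fun _ => homogeneousSubmodule (Fin 3) ℂ s

instance (s : ℕ) : FiniteDimensional ℂ (homTriples s) := by
  have : FiniteDimensional ℂ (homogeneousSubmodule (Fin 3) ℂ s) :=
    Module.Finite.iff_fg.mpr (homogeneousSubmodule_fg _ _ s)
  let f : homTriples s →ₗ[ℂ] (Fin 3 → homogeneousSubmodule (Fin 3) ℂ s) :=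
    LinearMap.pi fun i => (LinearMap.proj i ∘ₗ (homTriples s).subtype).codRestrict _
      fun x => x.2 i (Set.mem_univ i)
  refine Module.Finite.of_injective f fun x y hxy => ?_
  ext1
  funext i
  exact congrArg Subtype.val (congrFun hxy i)

instance {ι : Type*} (Z : ι → S) (Y : Finset ι) (s : ℕ) : FiniteDimensional ℂ (logForms Z Y s) :=
  Submodule.finiteDimensional_of_le (S₂ := homTriples s) fun _ h i _ => h.1 i

theorem logForms_zero {ι : Type*} (Z : ι → S) (Y : Finset ι) : logForms Z Y 0 = ⊥ := by
  rw [eq_bot_iff]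
  rintro ω ⟨h1, h2, -⟩
  have h3 : ∀ i, ω i = C (coeff 0 (ω i)) := fun i => by
    rw [← homogeneousComponent_zero, homogeneousComponent_eq_self (h1 i)]
  have h4 : linForm (fun i => coeff 0 (ω i)) = 0 := by
    rw [← h2, linForm]
    exact Finset.sum_congr rfl fun i _ => by rw [← h3 i, mul_comm]
  rw [linForm_eq_zero_iff] at h4
  rw [Submodule.mem_bot]
  funext i
  rw [h3 i, congrFun h4 i]
  simp

/-- A system of pairwise distinct smooth rational curves, with parametrizations whose points at
infinity lie on no other curve of the system, such that the total intersection multiplicity of any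
of the curves with the other ones is at most two at every point. -/
structure IsSystem {ι : Type*} (Z : ι → S) (e : ι → ℕ) (φ : ι → Fin 3 → Polynomial ℂ) : Prop where
  isHomogeneous : ∀ i, (Z i).IsHomogeneous (e i)
  prime : ∀ i, Prime (Z i)
  not_dvd : ∀ i j, i ≠ j → ¬ Z i ∣ Z j
  smooth : ∀ i (v : Fin 3 → ℂ), v ≠ 0 → ∃ a, eval v (pderiv a (Z i)) ≠ 0
  isParam : ∀ i, IsParam (Z i) (e i) (φ i)
  infinity : ∀ i j, i ≠ j → eval (fun a => (φ i a).coeff (e i)) (Z j) ≠ 0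
  mult : ∀ i (Y : Finset ι), i ∉ Y → ∀ t,
    (∏ j ∈ Y, aeval (φ i) (Z j)).rootMultiplicity t ≤ 2

/-! ### Restriction of invariant forms to one curve. -/

theorem exists_sum_mul_eq_one {n : Fin 3 → Polynomial ℂ} (h : ∀ t, ∃ a, (n a).eval t ≠ 0) :
    ∃ c : Fin 3 → Polynomial ℂ, ∑ a, c a * n a = 1 := by
  have htop : (1 : Polynomial ℂ) ∈ Ideal.span (Set.range n) := by
    rw [← Ideal.eq_top_iff_one]
    by_contra hne
    obtain ⟨M, hM, hle⟩ := Ideal.exists_le_maximal _ hne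
    obtain ⟨g, hg⟩ := (IsPrincipalIdealRing.principal M).principal
    have hdvd : ∀ a, g ∣ n a := fun a => by
      rw [← Ideal.mem_span_singleton]
      have := hle (Ideal.subset_span (Set.mem_range_self a))
      rwa [hg] at this
    have hnu : ¬ IsUnit g := fun hu => hM.ne_top (by
      rw [hg]
      exact Ideal.span_singleton_eq_top.mpr hu)
    obtain ⟨t, ht⟩ : ∃ t, g.eval t = 0 := by
      by_cases h0 : g = 0
      · exact ⟨0, by simp [h0]⟩
      · refine IsAlgClosed.exists_root g fun hd => hnu ?_
        exact Polynomial.isUnit_iff_degree_eq_zero.mpr hd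
    obtain ⟨a, ha⟩ := h t
    obtain ⟨q, hq⟩ := hdvd a
    exact ha (by rw [hq, Polynomial.eval_mul, ht, zero_mul])
  rw [Ideal.span, Submodule.mem_span_range_iff_exists_fun] at htop
  simpa using htop

/-- In characteristic zero `F'` vanishes at a root of `F` to one order less than `F`, so `w` must
supply the missing factor. -/
theorem eval_eq_zero_of_dvd_mul_derivative {F w : Polynomial ℂ} (hF : F ≠ 0)
    (h : F ∣ w * Polynomial.derivative F) {t : ℂ} (ht : F.eval t = 0) : w.eval t = 0 := by
  by_contra hw
  have hw0 : w ≠ 0 := by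
    rintro rfl
    simp at hw
  have hroot : F.IsRoot t := ht
  have hm := (Polynomial.rootMultiplicity_pos hF).mpr hroot
  have hd : Polynomial.derivative F ≠ 0 := by
    intro hd
    have h2 := Polynomial.derivative_eq_zero.mp hd
    obtain ⟨c, rfl⟩ := Polynomial.natDegree_eq_zero.mp h2
    simp only [Polynomial.eval_C] at ht
    exact hF (by rw [ht, Polynomial.C_0])
  have h1 := Polynomial.rootMultiplicity_le_rootMultiplicity_of_dvd (mul_ne_zero hw0 hd) h t
  rw [Polynomial.rootMultiplicity_mul (mul_ne_zero hw0 hd),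
    Polynomial.rootMultiplicity_eq_zero hw, Polynomial.derivative_rootMultiplicity_of_root hroot]
    at h1
  omega

theorem finrank_map_mulLeft_degreeLT_le (Q : Polynomial ℂ) (n : ℕ) :
    Module.finrank ℂ ((Polynomial.degreeLT ℂ n).map (LinearMap.mulLeft ℂ Q)) ≤ n := by
  have : FiniteDimensional ℂ (Polynomial.degreeLT ℂ n) :=
    Module.Finite.equiv (Polynomial.degreeLTEquiv ℂ n).symm
  refine (Submodule.finrank_map_le _ _).trans ?_
  rw [(Polynomial.degreeLTEquiv ℂ n).finrank_eq]
  simp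

namespace IsSystem

variable {ι : Type*} {Z : ι → S} {e : ι → ℕ} {φ : ι → Fin 3 → Polynomial ℂ}

theorem aeval_ne_zero (h : IsSystem Z e φ) {i j : ι} (hij : i ≠ j) : aeval (φ i) (Z j) ≠ 0 :=
  fun h0 => h.not_dvd i j hij ((h.isParam i).dvd_of_aeval_eq_zero _ _ (h.isHomogeneous j) h0)

theorem prod_ne_zero (h : IsSystem Z e φ) {i : ι} {Y : Finset ι} (hi : i ∉ Y) :
    ∏ j ∈ Y, aeval (φ i) (Z j) ≠ 0 :=
  Finset.prod_ne_zero_iff.mpr fun j hj => h.aeval_ne_zero (by rintro rfl; exact hi hj)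

theorem natDegree_aeval (h : IsSystem Z e φ) {i j : ι} (hij : i ≠ j) :
    (aeval (φ i) (Z j)).natDegree = e i * e j := by
  refine le_antisymm (natDegree_aeval_le (h.isParam i).natDegree_le (h.isHomogeneous j)) ?_
  apply Polynomial.le_natDegree_of_ne_zero
  rw [coeff_aeval (h.isParam i).natDegree_le (h.isHomogeneous j)]
  exact h.infinity i j hij

theorem natDegree_prod (h : IsSystem Z e φ) {i : ι} {Y : Finset ι} (hi : i ∉ Y) :
    (∏ j ∈ Y, aeval (φ i) (Z j)).natDegree = e i * ∑ j ∈ Y, e j := by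
  have hne : ∀ j ∈ Y, i ≠ j := fun j hj => by rintro rfl; exact hi hj
  rw [Polynomial.natDegree_prod _ _ fun j hj => h.aeval_ne_zero (hne j hj), Finset.mul_sum]
  exact Finset.sum_congr rfl fun j hj => h.natDegree_aeval (hne j hj)

/-- The parameters of the points of the curve `Z i = 0` on the curves `Z j = 0`, `j ∈ Y`. -/
def points (Z : ι → S) (φ : ι → Fin 3 → Polynomial ℂ) (i : ι) (Y : Finset ι) : Finset ℂ :=
  (∏ j ∈ Y, aeval (φ i) (Z j)).roots.toFinset

theorem mem_points (h : IsSystem Z e φ) {i : ι} {Y : Finset ι} (hi : i ∉ Y) {t : ℂ} :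
    t ∈ points Z φ i Y ↔ ∃ j ∈ Y, (aeval (φ i) (Z j)).eval t = 0 := by
  rw [points, Multiset.mem_toFinset, Polynomial.mem_roots (h.prod_ne_zero hi), Polynomial.IsRoot,
    Polynomial.eval_prod, Finset.prod_eq_zero_iff]

variable [DecidableEq ι]

/-- On `Z i = 0` an invariant form is `T ω` times the gradient. The multiplier `T ω` has degree at
most `e s - e (e - 1)` and vanishes at the points on the other curves, while a form with `T ω = 0`
is `Z i` times a form invariant for the remaining curves. -/
theorem finrank_logForms_insert_le (h : IsSystem Z e φ) {i : ι} {Y : Finset ι} (hi : i ∉ Y)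
    (s : ℕ) : Module.finrank ℂ (logForms Z (insert i Y) s) ≤
      (e i * s + 1 - e i * (e i - 1) - (points Z φ i Y).card) +
        Module.finrank ℂ (logForms Z Y (s - e i)) := by
  have hpar := h.isParam i
  set n : Fin 3 → Polynomial ℂ := fun a => aeval (φ i) (pderiv a (Z i)) with hn
  -- By smoothness the gradient has no zero along the curve, so its entries generate the unit ideal;
  -- the coefficients `c` extract the multiplier.
  obtain ⟨c, hc⟩ := exists_sum_mul_eq_one (n := n) fun t => by
    obtain ⟨a, ha⟩ := h.smooth i _ (hpar.ne_zero t)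
    exact ⟨a, by rwa [hn, eval_aeval_polynomial]⟩
  let T : (Fin 3 → S) →ₗ[ℂ] Polynomial ℂ :=
    ∑ a, LinearMap.mulLeft ℂ (c a) ∘ₗ (aeval (φ i)).toLinearMap ∘ₗ LinearMap.proj a
  have hT : ∀ ω, T ω = ∑ a, c a * aeval (φ i) (ω a) := fun ω => by
    simp [T, LinearMap.sum_apply]
  have hprop : ∀ ω ∈ logForms Z (insert i Y) s, ∀ b, aeval (φ i) (ω b) = T ω * n b := by
    rintro ω ⟨-, -, h3⟩ b
    have h4 : ∀ a, n a * aeval (φ i) (ω b) = n b * aeval (φ i) (ω a) := by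
      intro a
      obtain ⟨q, hq⟩ := h3 i (Finset.mem_insert_self i Y) a b
      have := congrArg (aeval (φ i)) hq
      rw [map_mul, hpar.aeval_eq_zero, zero_mul, map_sub, map_mul, map_mul] at this
      exact sub_eq_zero.mp this
    calc aeval (φ i) (ω b) = (∑ a, c a * n a) * aeval (φ i) (ω b) := by rw [hc, one_mul]
      _ = ∑ a, c a * (n a * aeval (φ i) (ω b)) := by
        rw [Finset.sum_mul]
        exact Finset.sum_congr rfl fun a _ => mul_assoc _ _ _
      _ = T ω * n b := by
        rw [hT, Finset.sum_mul]
        exact Finset.sum_congr rfl fun a _ => by rw [h4 a]; ring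
  set p := points Z φ i Y with hp
  set Q : Polynomial ℂ := ∏ t ∈ p, (Polynomial.X - Polynomial.C t) with hQ
  have hQdeg : Q.natDegree = p.card := by
    rw [hQ, Polynomial.natDegree_prod_of_monic _ _ fun t _ => Polynomial.monic_X_sub_C t]
    simp
  set M := e i * s + 1 - e i * (e i - 1) with hM
  have : FiniteDimensional ℂ (Polynomial.degreeLT ℂ (M - p.card)) :=
    Module.Finite.equiv (Polynomial.degreeLTEquiv ℂ _).symm
  refine (finrank_le_add_of_map (logForms Z (insert i Y) s) T
    ((Polynomial.degreeLT ℂ (M - p.card)).map (LinearMap.mulLeft ℂ Q))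
    ((logForms Z Y (s - e i)).map (LinearMap.mulLeft ℂ (fun _ => Z i : Fin 3 → S))) ?_ ?_).trans
    (add_le_add (finrank_map_mulLeft_degreeLT_le _ _) (Submodule.finrank_map_le _ _))
  · intro ω hω
    have hdeg : T ω ≠ 0 → (T ω).natDegree < M := by
      intro h0
      -- The gradient is nonzero at the point at infinity too, so one of its entries attains the
      -- full degree `e (e - 1)`.
      obtain ⟨b, hb⟩ := h.smooth i (fun a => (φ i a).coeff (e i)) (by
        obtain ⟨a, ha⟩ := hpar.lead_ne_zero
        exact fun h0 => ha (congrFun h0 a))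
      have hnb : (n b).natDegree = e i * (e i - 1) := by
        refine le_antisymm (natDegree_aeval_le hpar.natDegree_le (h.isHomogeneous i).pderiv) ?_
        apply Polynomial.le_natDegree_of_ne_zero
        rwa [hn, coeff_aeval hpar.natDegree_le (h.isHomogeneous i).pderiv]
      have hnb0 : n b ≠ 0 := by
        intro h0
        rw [← coeff_aeval hpar.natDegree_le (h.isHomogeneous i).pderiv] at hb
        change (n b).coeff _ ≠ 0 at hb
        rw [h0] at hb
        simp at hb
      have h1 := natDegree_aeval_le hpar.natDegree_le (hω.1 b)
      rw [hprop ω hω b, Polynomial.natDegree_mul h0 hnb0, hnb] at h1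
      omega
    have hroot : ∀ t ∈ p, (T ω).eval t = 0 := by
      intro t ht
      obtain ⟨j, hj, hjt⟩ := (h.mem_points hi).mp ht
      have hij : i ≠ j := by rintro rfl; exact hi hj
      refine eval_eq_zero_of_dvd_mul_derivative (h.aeval_ne_zero hij) ?_ hjt
      have hdv : ∀ a b, aeval (φ i) (Z j) ∣
          T ω * (aeval (φ i) (pderiv a (Z j)) * n b - aeval (φ i) (pderiv b (Z j)) * n a) := by
        intro a b
        have h1 := map_dvd (aeval (φ i)) (hω.2.2 j (Finset.mem_insert_of_mem hj) a b)
        rw [map_sub, map_mul, map_mul, hprop ω hω, hprop ω hω] at h1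
        convert h1 using 1
        ring
      have hF := derivative_aeval (φ i) (Z j)
      have h0 : ∑ a, n a * Polynomial.derivative (φ i a) = 0 := by
        rw [← derivative_aeval, hpar.aeval_eq_zero, map_zero]
      -- Contract the invariance relation for `Z j` with the velocity of the parametrization: the
      -- gradient of `Z i` kills the velocity, and that of `Z j` yields the derivative of the
      -- restriction.
      have hb : ∀ b, aeval (φ i) (Z j) ∣ T ω * Polynomial.derivative (aeval (φ i) (Z j)) * n b := by
        intro b
        have h1 : T ω * Polynomial.derivative (aeval (φ i) (Z j)) * n b =
            ∑ a, T ω * (aeval (φ i) (pderiv a (Z j)) * n b - aeval (φ i) (pderiv b (Z j)) * n a) *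
              Polynomial.derivative (φ i a) := by
          have h2 : ∑ a, T ω * (aeval (φ i) (pderiv a (Z j)) * n b -
              aeval (φ i) (pderiv b (Z j)) * n a) * Polynomial.derivative (φ i a) =
              T ω * n b * ∑ a, aeval (φ i) (pderiv a (Z j)) * Polynomial.derivative (φ i a) -
              T ω * aeval (φ i) (pderiv b (Z j)) * ∑ a, n a * Polynomial.derivative (φ i a) := by
            rw [Finset.mul_sum, Finset.mul_sum, ← Finset.sum_sub_distrib]
            exact Finset.sum_congr rfl fun a _ => by ring
          rw [h2, h0, hF]
          ring
        rw [h1]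
        exact Finset.dvd_sum fun a _ => (hdv a b).mul_right _
      have h1 : T ω * Polynomial.derivative (aeval (φ i) (Z j)) =
          ∑ b, c b * (T ω * Polynomial.derivative (aeval (φ i) (Z j)) * n b) := by
        calc _ = T ω * Polynomial.derivative (aeval (φ i) (Z j)) * ∑ a, c a * n a := by
              rw [hc, mul_one]
          _ = _ := by
            rw [Finset.mul_sum]
            exact Finset.sum_congr rfl fun a _ => by ring
      rw [h1]
      exact Finset.dvd_sum fun b _ => (hb b).mul_left _
    have hQT : Q ∣ T ω := by
      refine Finset.prod_dvd_of_coprime ?_ fun t ht => Polynomial.dvd_iff_isRoot.mpr (hroot t ht)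
      exact fun a _ b _ hab => Polynomial.pairwise_coprime_X_sub_C Function.injective_id hab
    obtain ⟨q, hq⟩ := hQT
    refine ⟨q, ?_, hq.symm⟩
    rw [SetLike.mem_coe, Polynomial.mem_degreeLT]
    by_cases hq0 : q = 0
    · rw [hq0, Polynomial.degree_zero]
      exact WithBot.bot_lt_coe _
    · have hQ0 : Q ≠ 0 := (Polynomial.monic_prod_of_monic _ _ fun t _ =>
        Polynomial.monic_X_sub_C t).ne_zero
      have h1 := hdeg (by rw [hq]; exact mul_ne_zero hQ0 hq0)
      rw [hq, Polynomial.natDegree_mul hQ0 hq0, hQdeg] at h1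
      rw [← Polynomial.natDegree_lt_iff_degree_lt hq0]
      omega
  · intro ω hω hTω
    have h0 : ∀ a, Z i ∣ ω a := fun a => by
      refine hpar.dvd_of_aeval_eq_zero _ _ (hω.1 a) ?_
      rw [hprop ω hω a, hTω, zero_mul]
    -- If `s < e i`, the quotient is zero, in accordance with the truncated degree `s - e i`.
    choose η hη1 hη2 _ using fun a =>
      exists_isHomogeneous_of_dvd (h.isHomogeneous i) (hω.1 a) (h0 a)
    refine ⟨η, ⟨hη1, ?_, ?_⟩, ?_⟩
    · have h1 := hω.2.1
      have h2 : Z i * ∑ a, X a * η a = 0 := by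
        rw [← h1, Finset.mul_sum]
        exact Finset.sum_congr rfl fun a _ => by rw [hη2 a]; ring
      exact (mul_eq_zero.mp h2).resolve_left (h.prime i).ne_zero
    · intro j hj a b
      have hij : i ≠ j := by rintro rfl; exact hi hj
      have h1 := hω.2.2 j (Finset.mem_insert_of_mem hj) a b
      rw [hη2 a, hη2 b] at h1
      have h2 : Z j ∣ Z i * (pderiv a (Z j) * η b - pderiv b (Z j) * η a) := by
        convert h1 using 1
        ring
      exact ((h.prime j).dvd_or_dvd h2).resolve_left (h.not_dvd j i hij.symm)
    · funext a
      exact (hη2 a).symm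

end IsSystem

/-! ### Jacobian syzygies of a free curve -/

/-- The Jacobian syzygies of degree `r` of `f`. -/
def syzygies (f : S) (r : ℕ) : Submodule ℂ (Fin 3 → S) where
  carrier := {ρ | (∀ i, (ρ i).IsHomogeneous r) ∧ ∑ i, ρ i * pderiv i f = 0}
  zero_mem' := ⟨fun i => isHomogeneous_zero _ _ _, by simp⟩
  add_mem' := by
    rintro ρ σ ⟨h1, h2⟩ ⟨k1, k2⟩
    exact ⟨fun i => (h1 i).add (k1 i), by simp [add_mul, Finset.sum_add_distrib, h2, k2]⟩
  smul_mem' := by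
    rintro c ρ ⟨h1, h2⟩
    refine ⟨fun i => ?_, ?_⟩
    · rw [Pi.smul_apply, smul_eq_C_mul]
      exact (h1 i).C_mul c
    · simp [← Finset.smul_sum, h2]

instance (f : S) (r : ℕ) : FiniteDimensional ℂ (syzygies f r) :=
  Submodule.finiteDimensional_of_le (S₂ := homTriples r) fun _ h i _ => h.1 i

theorem IsFree.mem_of_X_mul_mem {f h : S} (hf : IsFree f)
    (hh : ∀ i, X i * h ∈ jacobianIdeal f) : h ∈ jacobianIdeal f := by
  have h1 : Submodule.submoduleOf (jacobianIdeal f) (saturation (jacobianIdeal f)) = ⊤ :=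
    Submodule.Quotient.subsingleton_iff.mp hf
  have h2 : h ∈ saturation (jacobianIdeal f) := by
    refine Submodule.mem_iSup_of_mem 1 ?_
    rw [Submodule.mem_colon]
    intro p hp
    rw [pow_one] at hp
    have h3 : irrelevantIdeal ≤ Submodule.colon (jacobianIdeal f) {h} := by
      rw [irrelevantIdeal, Ideal.span_le]
      rintro _ ⟨i, rfl⟩
      rw [SetLike.mem_coe, Submodule.mem_colon_singleton]
      exact hh i
    have h4 := Submodule.mem_colon_singleton.mp (h3 hp)
    rwa [smul_eq_mul, mul_comm] at h4
  exact Submodule.submoduleOf_eq_top.mp h1 h2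

theorem linForm_add (a b : Fin 3 → ℂ) : linForm (a + b) = linForm a + linForm b := by
  simp [linForm, add_mul, Finset.sum_add_distrib]

theorem linForm_smul (c : ℂ) (a : Fin 3 → ℂ) : linForm (c • a) = C c * linForm a := by
  simp [linForm, Finset.mul_sum, mul_assoc]

theorem linForm_single (i : Fin 3) : linForm (Pi.single i 1) = X i := by
  rw [linForm, Finset.sum_eq_single i]
  · simp
  · intro b _ hb
    simp [hb]
  · simp

/-- For a free curve some linear form is a nonzerodivisor modulo the Jacobian ideal. -/
theorem IsFree.exists_linForm {f : S} (hf : IsFree f) :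
    ∃ a, linForm a ≠ 0 ∧ ∀ h, linForm a * h ∈ jacobianIdeal f → h ∈ jacobianIdeal f := by
  classical
  let J := jacobianIdeal f
  let sub : Ideal S → Submodule ℂ (Fin 3 → ℂ) := fun p =>
    { carrier := {a | linForm a ∈ p}
      zero_mem' := by
        change linForm 0 ∈ p
        rw [(linForm_eq_zero_iff 0).mpr rfl]
        exact p.zero_mem
      add_mem' := fun {a b} ha hb => by
        change linForm (a + b) ∈ p
        rw [linForm_add]
        exact p.add_mem ha hb
      smul_mem' := fun c a ha => by
        change linForm (c • a) ∈ p
        rw [linForm_smul]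
        exact p.mul_mem_left _ ha }
  have hfin := associatedPrimes.finite S (S ⧸ J)
  -- An associated prime containing all linear forms would contradict saturation, so each subspace
  -- is proper, and over an infinite field finitely many proper subspaces do not cover. Including
  -- `⊥` makes the chosen form nonzero.
  have htop : (⊤ : Submodule ℂ (Fin 3 → ℂ)) ∉ insert ⊥ (hfin.toFinset.image sub) := by
    intro hmem
    rw [Finset.mem_insert] at hmem
    rcases hmem with h | h
    · exact top_ne_bot h
    · obtain ⟨p, hp, hpt⟩ := Finset.mem_image.mp h
      rw [Set.Finite.mem_toFinset] at hp
      obtain ⟨hprime, x, hx⟩ := isAssociatedPrime_iff.mp hp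
      obtain ⟨h, rfl⟩ := Ideal.Quotient.mk_surjective x
      have hX : ∀ i, X i * h ∈ J := by
        intro i
        have h1 : (Pi.single i 1 : Fin 3 → ℂ) ∈ sub p := hpt ▸ Submodule.mem_top
        have h2 : X i ∈ p := linForm_single i ▸ h1
        rw [hx, Submodule.mem_colon_singleton, Submodule.mem_bot] at h2
        exact Ideal.Quotient.eq_zero_iff_mem.mp h2
      have h3 : Ideal.Quotient.mk J h = 0 :=
        Ideal.Quotient.eq_zero_iff_mem.mpr (hf.mem_of_X_mul_mem hX)
      apply hprime.ne_top
      rw [hx, h3, Ideal.eq_top_iff_one, Submodule.mem_colon_singleton]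
      simp
  obtain ⟨a, ha⟩ := (Set.ne_univ_iff_exists_notMem _).mp
    (Subspace.biUnion_ne_univ_of_top_notMem htop)
  simp only [Set.mem_iUnion, not_exists] at ha
  refine ⟨a, ?_, ?_⟩
  · intro h0
    refine ha ⊥ (Finset.mem_insert_self _ _) ?_
    exact (linForm_eq_zero_iff a).mp h0
  · intro h hmem
    by_contra hh
    have h1 : linForm a ∈ {r : S | ∃ x : S ⧸ J, x ≠ 0 ∧ r • x = 0} :=
      ⟨Ideal.Quotient.mk J h, fun h0 => hh (Ideal.Quotient.eq_zero_iff_mem.mp h0),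
        Ideal.Quotient.eq_zero_iff_mem.mpr hmem⟩
    rw [← biUnion_associatedPrimes_eq_zero_divisors] at h1
    simp only [Set.mem_iUnion] at h1
    obtain ⟨p, hp, hap⟩ := h1
    refine ha (sub p) (Finset.mem_insert_of_mem (Finset.mem_image_of_mem _ ?_)) hap
    rwa [Set.Finite.mem_toFinset]

theorem exists_isHomogeneous_of_mem_jacobianIdeal {f h : S} {m r : ℕ} (hf : f.IsHomogeneous (m + 1))
    (hh : h.IsHomogeneous (m + r)) (hJ : h ∈ jacobianIdeal f) :
    ∃ b : Fin 3 → S, (∀ i, (b i).IsHomogeneous r) ∧ h = ∑ i, b i * pderiv i f := by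
  rw [jacobianIdeal, Ideal.span, Submodule.mem_span_range_iff_exists_fun] at hJ
  obtain ⟨c, rfl⟩ := hJ
  refine ⟨fun i => homogeneousComponent r (c i),
    fun i => homogeneousComponent_isHomogeneous _ _, ?_⟩
  conv_lhs => rw [← homogeneousComponent_eq_self hh, map_sum]
  refine Finset.sum_congr rfl fun i _ => ?_
  rw [smul_eq_mul, mul_comm, homogeneousComponent_mul_of_left (m := m) hf.pderiv, mul_comm]

theorem IsFrame.exists_aeval_lineParam {b : Fin 3 → Fin 3 → ℂ} {l : Fin 3 → S} (h : IsFrame b l)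
    {r : ℕ} {q : Polynomial ℂ} (hq : q.natDegree ≤ r) :
    ∃ G : S, G.IsHomogeneous r ∧ aeval (lineParam b) G = q := by
  refine ⟨aeval ![l 0, l 1] (q.homogenize r), ?_, ?_⟩
  · have := (Polynomial.isHomogeneous_homogenize (n := r) q).aeval ![l 0, l 1] (n := 1) (by
      intro i
      fin_cases i
      · exact h.isHomogeneous 0
      · exact h.isHomogeneous 1)
    rwa [one_mul] at this
  · rw [← AlgHom.comp_apply, comp_aeval]
    have h0 := h.aeval_l ![Polynomial.X, 1, 0] 0
    have h1 := h.aeval_l ![Polynomial.X, 1, 0] 1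
    have h2 : (fun i => aeval (lineParam b) (![l 0, l 1] i)) = ![Polynomial.X, 1] := by
      funext i
      fin_cases i
      · exact h0
      · exact h1
    rw [h2, Polynomial.aeval_homogenize_X_one _ hq]

/-- Triples of polynomials in one variable of degree at most `r`. -/
abbrev polyTriples (r : ℕ) : Type := Fin 3 → Polynomial.degreeLT ℂ (r + 1)

theorem finrank_degreeLT (n : ℕ) : Module.finrank ℂ (Polynomial.degreeLT ℂ n) = n := by
  rw [(Polynomial.degreeLTEquiv ℂ n).finrank_eq]
  simp

instance (n : ℕ) : FiniteDimensional ℂ (Polynomial.degreeLT ℂ n) :=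
  Module.Finite.equiv (Polynomial.degreeLTEquiv ℂ n).symm

theorem mem_degreeLT_succ_iff {n : ℕ} {p : Polynomial ℂ} :
    p ∈ Polynomial.degreeLT ℂ (n + 1) ↔ p.natDegree ≤ n := by
  rw [Polynomial.mem_degreeLT, Polynomial.degree_lt_iff_coeff_zero,
    Polynomial.natDegree_le_iff_coeff_eq_zero]
  rfl

/-- Restrict to a line `L = 0` with `L` a nonzerodivisor modulo the Jacobian ideal. Relations of
degree `r + 1` there are the kernel of a map from dimension `3 (r + 2)` to dimension at most `r + m
+ 2`. All of them lift to syzygies, and restriction kills `L` times the syzygies of degree `r`. -/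
theorem IsFree.finrank_syzygies_succ {f : S} (hf : IsFree f) {m : ℕ} (hm : f.IsHomogeneous (m + 1))
    (r : ℕ) : 3 * (r + 2) + Module.finrank ℂ (syzygies f r) ≤
      Module.finrank ℂ (syzygies f (r + 1)) + (r + m + 2) := by
  obtain ⟨a, ha0, ha⟩ := hf.exists_linForm
  have haL := linForm_isHomogeneous a
  obtain ⟨q₀, hq₀, hPq₀⟩ := exists_ne_zero_eval_eq_zero haL
  obtain ⟨b, l, κ, hbl, hκ, hPl, -⟩ := exists_isFrame_line haL ha0 hq₀ hPq₀
  have hφ := hbl.isParam_line hκ hPl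
  set φ := lineParam b
  have hdeg : ∀ i, (aeval φ (pderiv i f)).natDegree ≤ m := fun i => by
    simpa using natDegree_aeval_le hφ.natDegree_le (hm.pderiv (i := i))
  let Ψ : polyTriples (r + 1) →ₗ[ℂ] Polynomial ℂ :=
    ∑ i, LinearMap.mulRight ℂ (aeval φ (pderiv i f)) ∘ₗ
      (Polynomial.degreeLT ℂ (r + 1 + 1)).subtype ∘ₗ LinearMap.proj i
  have hΨ : ∀ q, Ψ q = ∑ i, (q i : Polynomial ℂ) * aeval φ (pderiv i f) := fun q => by
    simp [Ψ, LinearMap.sum_apply]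
  have hrange : Module.finrank ℂ Ψ.range ≤ r + m + 2 := by
    rw [← finrank_degreeLT (r + m + 2)]
    apply Submodule.finrank_mono
    rintro _ ⟨q, rfl⟩
    rw [hΨ]
    rw [show r + m + 2 = (r + 1 + m) + 1 by ring, mem_degreeLT_succ_iff]
    refine Polynomial.natDegree_sum_le_of_forall_le _ _ fun i _ => ?_
    exact Polynomial.natDegree_mul_le.trans
      (add_le_add (mem_degreeLT_succ_iff.mp (q i).2) (hdeg i))
  have hker := Ψ.finrank_range_add_finrank_ker
  have hdom : Module.finrank ℂ (polyTriples (r + 1)) = 3 * (r + 2) := by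
    rw [Module.finrank_pi_fintype]
    simp [finrank_degreeLT]
  rw [hdom] at hker
  let T : (Fin 3 → S) →ₗ[ℂ] (Fin 3 → Polynomial ℂ) :=
    LinearMap.pi fun i => (aeval φ).toLinearMap ∘ₗ LinearMap.proj i
  have hT : ∀ ρ i, T ρ i = aeval φ (ρ i) := fun ρ i => rfl
  have hsyz := (T.domRestrict (syzygies f (r + 1))).finrank_range_add_finrank_ker
  have h1 : Module.finrank ℂ Ψ.ker ≤
      Module.finrank ℂ (T.domRestrict (syzygies f (r + 1))).range := by
    let ι : polyTriples (r + 1) →ₗ[ℂ] (Fin 3 → Polynomial ℂ) :=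
      LinearMap.pi fun i => (Polynomial.degreeLT ℂ (r + 1 + 1)).subtype ∘ₗ LinearMap.proj i
    have hι : Function.Injective ι := fun x y hxy => by
      funext i
      exact Subtype.ext (congrFun hxy i)
    rw [(Submodule.equivMapOfInjective ι hι Ψ.ker).finrank_eq]
    apply Submodule.finrank_mono
    rintro _ ⟨q, hq, rfl⟩
    choose G hG hGq using fun i =>
      hbl.exists_aeval_lineParam (mem_degreeLT_succ_iff.mp (q i).2)
    have hsum : (∑ i, G i * pderiv i f).IsHomogeneous (r + 1 + m) :=
      IsHomogeneous.sum _ _ _ fun i _ => (hG i).mul hm.pderiv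
    have hvan : aeval φ (∑ i, G i * pderiv i f) = 0 := by
      rw [map_sum, ← LinearMap.mem_ker.mp hq, hΨ]
      exact Finset.sum_congr rfl fun i _ => by rw [map_mul, hGq i]
    obtain ⟨h, hh, hhe, -⟩ := exists_isHomogeneous_of_dvd haL hsum
      (hφ.dvd_of_aeval_eq_zero _ _ hsum hvan)
    -- An arbitrary lift `G` only gives an element `L h` of the Jacobian ideal. Cancelling `L`
    -- yields `h = ∑ c i * ∂ᵢ f`, and `G - L c` is a true syzygy with the same restriction.
    have hJ : h ∈ jacobianIdeal f := by
      apply ha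
      rw [← hhe]
      exact Ideal.sum_mem _ fun i _ => Ideal.mul_mem_left _ _ (Ideal.subset_span ⟨i, rfl⟩)
    obtain ⟨c, hc, hch⟩ := exists_isHomogeneous_of_mem_jacobianIdeal (r := r) hm
      (by rwa [show r + 1 + m - 1 = m + r by omega] at hh) hJ
    refine ⟨⟨fun i => G i - linForm a * c i, fun i => ?_, ?_⟩, ?_⟩
    · refine (hG i).sub ?_
      rw [add_comm r 1]
      exact haL.mul (hc i)
    · simp only [sub_mul, Finset.sum_sub_distrib, mul_assoc, ← Finset.mul_sum]
      rw [hhe, hch, sub_self]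
    · funext i
      change aeval φ (G i - linForm a * c i) = q i
      rw [map_sub, map_mul, hφ.aeval_eq_zero, zero_mul, sub_zero]
      exact hGq i
  have h2 : Module.finrank ℂ (syzygies f r) ≤
      Module.finrank ℂ (T.domRestrict (syzygies f (r + 1))).ker := by
    let μ : (Fin 3 → S) →ₗ[ℂ] (Fin 3 → S) := LinearMap.mulLeft ℂ fun _ => linForm a
    have hμ : Function.Injective μ := fun x y hxy => by
      funext i
      exact mul_left_cancel₀ ha0 (congrFun hxy i)
    rw [(Submodule.equivMapOfInjective μ hμ (syzygies f r)).finrank_eq,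
      (Submodule.equivMapOfInjective (syzygies f (r + 1)).subtype
        (syzygies f (r + 1)).injective_subtype _).finrank_eq]
    apply Submodule.finrank_mono
    rintro _ ⟨ρ, hρ, rfl⟩
    refine ⟨⟨μ ρ, fun i => ?_, ?_⟩, ?_, rfl⟩
    · rw [add_comm r 1]
      exact haL.mul (hρ.1 i)
    · have : ∀ i, μ ρ i * pderiv i f = linForm a * (ρ i * pderiv i f) := fun i => mul_assoc _ _ _
      simp only [this, ← Finset.mul_sum]
      rw [hρ.2, mul_zero]
    · change T (μ ρ) = 0
      funext i
      change aeval φ (linForm a * ρ i) = 0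
      rw [map_mul, hφ.aeval_eq_zero, zero_mul]
  omega

/-- The `1`-form obtained by contracting the volume form with the Euler field and a vector field. -/
def contract : (Fin 3 → S) →ₗ[ℂ] (Fin 3 → S) where
  toFun ρ := ![X 1 * ρ 2 - X 2 * ρ 1, X 2 * ρ 0 - X 0 * ρ 2, X 0 * ρ 1 - X 1 * ρ 0]
  map_add' ρ σ := by
    funext i
    fin_cases i <;> simp <;> ring
  map_smul' c ρ := by
    funext i
    fin_cases i <;> simp [smul_sub]

/-- The contraction is injective on syzygies: its kernel consists of fields proportional to the
Euler field, and Euler's identity lets only zero annihilate `f`. The invariance holds because each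
`Z j` is a prime factor occurring only once, so the field is tangent to it. -/
theorem finrank_syzygies_le {ι : Type*} [DecidableEq ι] {Z : ι → S} {e : ι → ℕ} {Y : Finset ι}
    (hhom : ∀ i, (Z i).IsHomogeneous (e i)) (hprime : ∀ i, Prime (Z i))
    (hdvd : ∀ i j, i ≠ j → ¬ Z i ∣ Z j) {m : ℕ} (hm : (∏ j ∈ Y, Z j).IsHomogeneous (m + 1))
    (r : ℕ) : Module.finrank ℂ (syzygies (∏ j ∈ Y, Z j) r) ≤
      Module.finrank ℂ (logForms Z Y (r + 1)) := by
  set f := ∏ j ∈ Y, Z j with hf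
  have hf0 : f ≠ 0 := Finset.prod_ne_zero_iff.mpr fun j _ => (hprime j).ne_zero
  have := finrank_le_add_of_map (syzygies f r) contract (logForms Z Y (r + 1)) ⊥ ?_ ?_
  · simpa using this
  · rintro ρ ⟨h1, h2⟩
    have hX : ∀ i j, (X i * ρ j : S).IsHomogeneous (r + 1) := fun i j => by
      rw [add_comm r 1]
      exact (isHomogeneous_X ℂ i).mul (h1 j)
    refine ⟨fun i => ?_, ?_, ?_⟩
    · fin_cases i
      · exact (hX 1 2).sub (hX 2 1)
      · exact (hX 2 0).sub (hX 0 2)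
      · exact (hX 0 1).sub (hX 1 0)
    · simp only [contract, LinearMap.coe_mk, AddHom.coe_mk, Fin.sum_univ_three,
        Matrix.cons_val_zero, Matrix.cons_val_one, Matrix.cons_val]
      ring
    · intro j hj
      have hfj : f = Z j * ∏ i ∈ Y.erase j, Z i := (Finset.mul_prod_erase Y Z hj).symm
      set g := ∏ i ∈ Y.erase j, Z i with hg
      have hndvd : ¬ Z j ∣ g := by
        intro h
        obtain ⟨i, hi, hij⟩ := (hprime j).exists_mem_finset_dvd h
        exact hdvd j i (Finset.ne_of_mem_erase hi).symm hij
      have h3 : Z j ∣ ∑ i, ρ i * pderiv i (Z j) := by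
        have h4 : Z j ∣ g * ∑ i, ρ i * pderiv i (Z j) := by
          refine ⟨-∑ i, ρ i * pderiv i g, ?_⟩
          rw [hfj] at h2
          simp only [Derivation.leibniz, smul_eq_mul, Fin.sum_univ_three] at h2 ⊢
          linear_combination h2
        exact ((hprime j).dvd_or_dvd h4).resolve_left hndvd
      obtain ⟨w, hw⟩ := h3
      have hE := (hhom j).sum_X_mul_pderiv
      rw [nsmul_eq_mul] at hE
      rw [Fin.sum_univ_three] at hw hE
      intro a b
      fin_cases a <;> fin_cases b <;>
        simp only [contract, LinearMap.coe_mk, AddHom.coe_mk, Fin.zero_eta, Fin.mk_one,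
          Fin.reduceFinMk, Matrix.cons_val_zero, Matrix.cons_val_one, Matrix.cons_val, sub_self,
          dvd_zero]
      -- Up to sign each minor is `X c * ρ(Z j) - ρ c * E(Z j)` with `E` the Euler field and `c` the
      -- third index; `Z j` divides both terms.
      · exact ⟨X 2 * w - (e j : S) * ρ 2, by linear_combination X 2 * hw - ρ 2 * hE⟩
      · exact ⟨-(X 1 * w - (e j : S) * ρ 1), by linear_combination -X 1 * hw + ρ 1 * hE⟩
      · exact ⟨-(X 2 * w - (e j : S) * ρ 2), by linear_combination -X 2 * hw + ρ 2 * hE⟩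
      · exact ⟨X 0 * w - (e j : S) * ρ 0, by linear_combination X 0 * hw - ρ 0 * hE⟩
      · exact ⟨X 1 * w - (e j : S) * ρ 1, by linear_combination X 1 * hw - ρ 1 * hE⟩
      · exact ⟨-(X 0 * w - (e j : S) * ρ 0), by linear_combination -X 0 * hw + ρ 0 * hE⟩
  · rintro ρ ⟨h1, h2⟩ h3
    have e0 : X 1 * ρ 2 - X 2 * ρ 1 = 0 := congrFun h3 0
    have e1 : X 2 * ρ 0 - X 0 * ρ 2 = 0 := congrFun h3 1
    have e2 : X 0 * ρ 1 - X 1 * ρ 0 = 0 := congrFun h3 2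
    have hE := hm.sum_X_mul_pderiv
    rw [nsmul_eq_mul, Fin.sum_univ_three] at hE
    rw [Fin.sum_univ_three] at h2
    have hmf : ((m + 1 : ℕ) : S) * f ≠ 0 := mul_ne_zero (by exact_mod_cast Nat.succ_ne_zero m) hf0
    rw [Submodule.mem_bot]
    funext i
    refine (mul_eq_zero.mp (?_ : ρ i * (((m + 1 : ℕ) : S) * f) = 0)).resolve_right hmf
    rw [← hE]
    fin_cases i
    · change ρ 0 * _ = 0
      linear_combination X 0 * h2 - pderiv 1 f * e2 + pderiv 2 f * e1
    · change ρ 1 * _ = 0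
      linear_combination X 1 * h2 + pderiv 0 f * e2 - pderiv 2 f * e0
    · change ρ 2 * _ = 0
      linear_combination X 2 * h2 - pderiv 0 f * e1 + pderiv 1 f * e0

/-! ### Counting intersection points -/

theorem rootMultiplicity_eq_natDegree {F : Polynomial ℂ} {t : ℂ} (h : ∀ x, F.eval x = 0 → x = t)
    (hF : F ≠ 0) : F.rootMultiplicity t = F.natDegree := by
  classical
  have h1 : F.roots.card = F.natDegree :=
    (IsAlgClosed.card_roots_eq_natDegree).trans rfl
  have h2 : F.roots = Multiset.replicate F.roots.card t :=
    Multiset.eq_replicate_card.mpr fun x hx => h x ((Polynomial.mem_roots hF).mp hx)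
  rw [← Polynomial.count_roots, ← h1]
  conv_lhs => rw [h2]
  simp

theorem eq_C_mul_pow_of_unique_root {F : Polynomial ℂ} {t : ℂ} (h : ∀ x, F.eval x = 0 → x = t)
    (hF : F ≠ 0) : ∃ κ : ℂ, κ ≠ 0 ∧
      F = Polynomial.C κ * (Polynomial.X - Polynomial.C t) ^ F.natDegree := by
  obtain ⟨q, hq⟩ := Polynomial.pow_rootMultiplicity_dvd F t
  rw [rootMultiplicity_eq_natDegree h hF] at hq
  have hq0 : q ≠ 0 := by
    rintro rfl
    exact hF (by rw [hq, mul_zero])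
  have h1 := congrArg Polynomial.natDegree hq
  rw [Polynomial.natDegree_mul (pow_ne_zero _ (Polynomial.X_sub_C_ne_zero t)) hq0,
    Polynomial.natDegree_pow, Polynomial.natDegree_X_sub_C, mul_one] at h1
  obtain ⟨κ, rfl⟩ := Polynomial.natDegree_eq_zero.mp (by omega : q.natDegree = 0)
  refine ⟨κ, fun h0 => hq0 (by rw [h0, Polynomial.C_0]), ?_⟩
  rw [mul_comm]
  exact hq

namespace IsSystem

variable {ι : Type*} {Z : ι → S} {e : ι → ℕ} {φ : ι → Fin 3 → Polynomial ℂ}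

/-- This is Bézout's count: every point contributes at most two to the total degree, and those in
`W` at most one. -/
theorem natDegree_add_card_le (h : IsSystem Z e φ) {i : ι} {Y : Finset ι} (hi : i ∉ Y)
    (W : Finset ℂ) (hW : W ⊆ points Z φ i Y)
    (hW1 : ∀ t ∈ W, (∏ j ∈ Y, aeval (φ i) (Z j)).rootMultiplicity t ≤ 1) :
    e i * ∑ j ∈ Y, e j + W.card ≤ 2 * (points Z φ i Y).card := by
  classical
  rw [← h.natDegree_prod hi, ← IsAlgClosed.card_roots_eq_natDegree,
    ← Multiset.toFinset_sum_count_eq]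
  have h1 : W.card = ∑ t ∈ points Z φ i Y, if t ∈ W then 1 else 0 := by
    rw [Finset.sum_ite_mem, Finset.inter_eq_right.mpr hW]
    simp
  rw [h1]
  change ∑ t ∈ points Z φ i Y, _ + _ ≤ _
  rw [← Finset.sum_add_distrib, mul_comm, ← smul_eq_mul]
  refine Finset.sum_le_card_nsmul _ _ _ fun t _ => ?_
  rw [Polynomial.count_roots]
  split_ifs with ht
  · exact Nat.add_le_add_right (hW1 t ht) 1
  · exact h.mult i Y hi t

theorem natDegree_le (h : IsSystem Z e φ) {i : ι} {Y : Finset ι} (hi : i ∉ Y) :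
    e i * ∑ j ∈ Y, e j ≤ 2 * (points Z φ i Y).card := by
  simpa using h.natDegree_add_card_le hi ∅ (by simp) (by simp)

theorem eval_self (h : IsSystem Z e φ) (i : ι) (t : ℂ) :
    eval (fun a => (φ i a).eval t) (Z i) = 0 := by
  rw [← eval_aeval_polynomial, (h.isParam i).aeval_eq_zero, Polynomial.eval_zero]

/-- A nonzero point on two curves of the system has a parameter on the first one. -/
theorem exists_param (h : IsSystem Z e φ) {i j : ι} (hij : i ≠ j) {y : Fin 3 → ℂ} (hy : y ≠ 0)
    (hi : eval y (Z i) = 0) (hj : eval y (Z j) = 0) :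
    ∃ t c : ℂ, c ≠ 0 ∧ y = c • fun a => (φ i a).eval t := by
  rcases (h.isParam i).exists_eq y hi with ⟨t, c, hc⟩ | ⟨c, hc⟩
  · refine ⟨t, c, ?_, funext hc⟩
    rintro rfl
    exact hy (funext fun a => by simp [hc a])
  · exfalso
    have hy' : y = c • fun a => (φ i a).coeff (e i) := funext hc
    have hc0 : c ≠ 0 := by
      rintro rfl
      exact hy (by rw [hy', zero_smul])
    rw [hy', IsHomogeneous.eval_smul (h.isHomogeneous j)] at hj
    exact (mul_ne_zero (pow_ne_zero _ hc0) (h.infinity i j hij)) hj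

theorem eval_smul_eq_zero_iff (h : IsSystem Z e φ) (j : ι) {c : ℂ} (hc : c ≠ 0)
    (y : Fin 3 → ℂ) : eval (c • y) (Z j) = 0 ↔ eval y (Z j) = 0 := by
  rw [IsHomogeneous.eval_smul (h.isHomogeneous j)]
  simp [hc]

/-- The parameter on `Z j = 0` of a point of `Z i = 0` lying on `Z j = 0`. -/
theorem exists_transfer (h : IsSystem Z e φ) {i j : ι} (hij : i ≠ j) {t : ℂ}
    (ht : (aeval (φ i) (Z j)).eval t = 0) :
    ∃ τ c : ℂ, c ≠ 0 ∧ (fun a => (φ i a).eval t) = c • fun a => (φ j a).eval τ :=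
  h.exists_param hij.symm ((h.isParam i).ne_zero t) (by rw [← eval_aeval_polynomial, ht]) (h.eval_self i t)

theorem unique_root_symm (h : IsSystem Z e φ) {i j : ι} (hij : i ≠ j)
    (hu : ∀ t t', (aeval (φ i) (Z j)).eval t = 0 → (aeval (φ i) (Z j)).eval t' = 0 → t = t') :
    ∀ τ τ', (aeval (φ j) (Z i)).eval τ = 0 → (aeval (φ j) (Z i)).eval τ' = 0 → τ = τ' := by
  intro τ τ' hτ hτ'
  obtain ⟨t, c, hc, ht⟩ := h.exists_transfer hij.symm hτ
  obtain ⟨t', c', hc', ht'⟩ := h.exists_transfer hij.symm hτ'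
  have key : ∀ τ t c : ℂ, c ≠ 0 → (fun a => (φ j a).eval τ) = c • (fun a => (φ i a).eval t) →
      (aeval (φ i) (Z j)).eval t = 0 := by
    intro τ t c hc h1
    have h2 := h.eval_self j τ
    rw [h1, h.eval_smul_eq_zero_iff j hc] at h2
    rw [eval_aeval_polynomial, h2]
  have htt := hu t t' (key τ t c hc ht) (key τ' t' c' hc' ht')
  subst htt
  refine (h.isParam j).injective τ τ' (c * c'⁻¹) fun a => ?_
  have h1 := congrFun ht a
  have h2 := congrFun ht' a
  simp only [Pi.smul_apply, smul_eq_mul] at h1 h2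
  rw [h1, h2]
  field_simp

theorem exists_root (h : IsSystem Z e φ) {i j : ι} (hij : i ≠ j) (hi : e i ≠ 0) (hj : e j ≠ 0) :
    ∃ t, (aeval (φ i) (Z j)).eval t = 0 := by
  refine IsAlgClosed.exists_root _ fun h0 => ?_
  have := Polynomial.natDegree_eq_of_degree_eq_some h0
  rw [h.natDegree_aeval hij] at this
  exact mul_ne_zero hi hj this

theorem one_le_rootMultiplicity (h : IsSystem Z e φ) {i j : ι} (hij : i ≠ j) {t : ℂ}
    (ht : (aeval (φ i) (Z j)).eval t = 0) : 1 ≤ (aeval (φ i) (Z j)).rootMultiplicity t :=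
  (Polynomial.rootMultiplicity_pos (h.aeval_ne_zero hij)).mpr ht

/-- Two distinct lines have only one common point. -/
theorem eval_eq_zero_of_two_lines (h : IsSystem Z e φ) {i j : ι} (hij : i ≠ j) (hi1 : e i = 1)
    (hj1 : e j = 1) {y z : Fin 3 → ℂ} (hy : y ≠ 0) (hz : z ≠ 0) (hyi : eval y (Z i) = 0)
    (hyj : eval y (Z j) = 0) (hzi : eval z (Z i) = 0) (hzj : eval z (Z j) = 0) {l : ι}
    (hzl : eval z (Z l) = 0) : eval y (Z l) = 0 := by
  obtain ⟨t, c, hc, rfl⟩ := h.exists_param hij hy hyi hyj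
  obtain ⟨t', c', hc', rfl⟩ := h.exists_param hij hz hzi hzj
  rw [h.eval_smul_eq_zero_iff _ hc] at hyj ⊢
  rw [h.eval_smul_eq_zero_iff _ hc'] at hzj hzl
  have htt : t = t' := by
    by_contra hne
    have h1 : ({t, t'} : Finset ℂ).card ≤ (aeval (φ i) (Z j)).roots.toFinset.card := by
      apply Finset.card_le_card
      intro x hx
      rw [Multiset.mem_toFinset, Polynomial.mem_roots (h.aeval_ne_zero hij), Polynomial.IsRoot,
        eval_aeval_polynomial]
      rcases Finset.mem_insert.mp hx with rfl | hx
      · exact hyj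
      · rw [Finset.mem_singleton.mp hx]
        exact hzj
    rw [Finset.card_pair hne] at h1
    have h2 := (Multiset.toFinset_card_le _).trans (Polynomial.card_roots' (aeval (φ i) (Z j)))
    rw [h.natDegree_aeval hij, hi1, hj1] at h2
    omega
  rw [htt]
  exact hzl

variable [DecidableEq ι]

theorem mult_pair (h : IsSystem Z e φ) {i j l : ι} (hij : i ≠ j) (hil : i ≠ l) (hjl : j ≠ l)
    (t : ℂ) : (aeval (φ i) (Z j)).rootMultiplicity t + (aeval (φ i) (Z l)).rootMultiplicity t ≤ 2 := by
  have h1 := h.mult i {j, l} (by simp [hij, hil]) t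
  rwa [Finset.prod_pair hjl, Polynomial.rootMultiplicity_mul
    (mul_ne_zero (h.aeval_ne_zero hij) (h.aeval_ne_zero hil))] at h1

/-- No point lies on four curves of the system. -/
theorem not_mem_four (h : IsSystem Z e φ) {i j l m : ι} (hij : i ≠ j) (hil : i ≠ l) (him : i ≠ m)
    (hjl : j ≠ l) (hjm : j ≠ m) (hlm : l ≠ m) {y : Fin 3 → ℂ} (hy : y ≠ 0)
    (hi : eval y (Z i) = 0) (hj : eval y (Z j) = 0) (hl : eval y (Z l) = 0)
    (hm : eval y (Z m) = 0) : False := by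
  obtain ⟨t, c, hc, rfl⟩ := h.exists_param hij hy hi hj
  rw [h.eval_smul_eq_zero_iff _ hc, ← eval_aeval_polynomial] at hj hl hm
  have h1 := h.mult i {j, l, m} (by simp [hij, hil, him]) t
  rw [Finset.prod_insert (by simp [hjl, hjm]), Finset.prod_pair hlm,
    Polynomial.rootMultiplicity_mul (mul_ne_zero (h.aeval_ne_zero hij)
      (mul_ne_zero (h.aeval_ne_zero hil) (h.aeval_ne_zero him))),
    Polynomial.rootMultiplicity_mul (mul_ne_zero (h.aeval_ne_zero hil) (h.aeval_ne_zero him))] at h1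
  have := h.one_le_rootMultiplicity hij hj
  have := h.one_le_rootMultiplicity hil hl
  have := h.one_le_rootMultiplicity him hm
  omega

/-- There are no forms of low degree leaving invariant some conics and the sides of a triangle. -/
theorem logForms_triangle_eq_zero (h : IsSystem Z e φ) {T : Finset ι} (hT : T.card = 3)
    (hT1 : ∀ j ∈ T, e j = 1)
    (hcon : ∀ y : Fin 3 → ℂ, y ≠ 0 → ∃ j ∈ T, eval y (Z j) ≠ 0) (D : Finset ι)
    (hD : ∀ j ∈ D, e j = 2) (s : ℕ) (hs : s ≤ D.card + 1) :
    Module.finrank ℂ (logForms Z (D ∪ T) s) = 0 := by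
  induction D using Finset.induction_on generalizing s with
  | empty =>
    obtain ⟨i, j, l, hij, hil, hjl, rfl⟩ := Finset.card_eq_three.mp hT
    have hi1 := hT1 i (by simp)
    have hj1 := hT1 j (by simp)
    have hl1 := hT1 l (by simp)
    have hnot : i ∉ ({j, l} : Finset ι) := by simp [hij, hil]
    have h1 := h.finrank_logForms_insert_le hnot s
    rw [Finset.card_empty] at hs
    rw [show s - e i = 0 by omega, logForms_zero, finrank_bot, hi1] at h1
    -- One side meets the other two in different points, so a multiplier of degree at most one has
    -- two zeros and vanishes.
    obtain ⟨t, ht⟩ := h.exists_root hij (by omega) (by omega)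
    obtain ⟨t', ht'⟩ := h.exists_root hil (by omega) (by omega)
    have hne : t ≠ t' := by
      rintro rfl
      obtain ⟨m, hm, hm0⟩ := hcon _ ((h.isParam i).ne_zero t)
      simp only [Finset.mem_insert, Finset.mem_singleton] at hm
      rcases hm with rfl | rfl | rfl
      · exact hm0 (h.eval_self _ t)
      · exact hm0 (by rw [← eval_aeval_polynomial, ht])
      · exact hm0 (by rw [← eval_aeval_polynomial, ht'])
    have h2 : ({t, t'} : Finset ℂ).card ≤ (points Z φ i {j, l}).card := by
      apply Finset.card_le_card
      intro x hx
      rw [h.mem_points hnot]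
      rcases Finset.mem_insert.mp hx with rfl | hx
      · exact ⟨j, by simp, ht⟩
      · exact ⟨l, by simp, by rw [Finset.mem_singleton.mp hx]; exact ht'⟩
    rw [Finset.card_pair hne] at h2
    rw [Finset.empty_union]
    omega
  | insert c D hc ih =>
    have hc2 := hD c (Finset.mem_insert_self c D)
    have hD' : ∀ j ∈ D, e j = 2 := fun j hj => hD j (Finset.mem_insert_of_mem hj)
    have hcT : c ∉ D ∪ T := by
      rw [Finset.mem_union]
      rintro (h1 | h1)
      · exact hc h1
      · have := hT1 c h1
        omega
    have hdisj : Disjoint D T := Finset.disjoint_left.mpr fun j h1 h2 => by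
      have := hD' j h1
      have := hT1 j h2
      omega
    rw [Finset.card_insert_of_notMem hc] at hs
    -- The conic meets the remaining curves in at least `2 |D| + 3` points, and the space of
    -- multipliers has dimension at most `2 s - 1 ≤ 2 |D| + 3` before these zeros are imposed.
    have h1 := h.finrank_logForms_insert_le hcT s
    have h2 := h.natDegree_le hcT
    rw [Finset.sum_union hdisj, Finset.sum_congr rfl hD', Finset.sum_congr rfl hT1] at h2
    simp only [Finset.sum_const, hT, smul_eq_mul, hc2] at h2
    rw [ih hD' (s - e c) (by omega), hc2] at h1
    rw [Finset.insert_union]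
    omega

end IsSystem

/-! ### Four lines and some conics -/

namespace IsSystem

variable {k : ℕ} {Z : Fin 4 ⊕ Fin k → S} {e : Fin 4 ⊕ Fin k → ℕ}
  {φ : Fin 4 ⊕ Fin k → Fin 3 → Polynomial ℂ}

/-- All curves except the line `a` and the conic `c`. -/
def others (a : Fin 4) (c : Fin k) : Finset (Fin 4 ⊕ Fin k) :=
  (Finset.univ.erase c).map Function.Embedding.inr ∪ (Finset.univ.erase a).map Function.Embedding.inl

theorem mem_others {a : Fin 4} {c : Fin k} {j : Fin 4 ⊕ Fin k} :
    j ∈ others a c ↔ j ≠ Sum.inl a ∧ j ≠ Sum.inr c := by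
  rcases j with j | j <;> simp [others]

theorem insert_insert_others (a : Fin 4) (c : Fin k) :
    insert (Sum.inr c) (insert (Sum.inl a) (others a c)) = Finset.univ := by
  ext j
  simp only [Finset.mem_insert, mem_others, Finset.mem_univ, iff_true]
  tauto

theorem sum_others (he1 : ∀ a, e (Sum.inl a) = 1) (he2 : ∀ c, e (Sum.inr c) = 2) (a : Fin 4)
    (c : Fin k) : ∑ j ∈ others a c, e j + 2 = 2 * k + 3 := by
  have hk : 1 ≤ k := c.pos
  have hdisj : Disjoint ((Finset.univ.erase c).map (Function.Embedding.inr (α := Fin 4)))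
      ((Finset.univ.erase a).map Function.Embedding.inl) := by
    rw [Finset.disjoint_left]
    rintro (j | j) <;> simp
  rw [others, Finset.sum_union hdisj, Finset.sum_map, Finset.sum_map]
  simp only [Function.Embedding.inr_apply, Function.Embedding.inl_apply, he1, he2,
    Finset.sum_const, Finset.card_erase_of_mem (Finset.mem_univ _), Finset.card_univ,
    Fintype.card_fin, smul_eq_mul]
  omega

/-- The lines other than `a` have no common point. -/
def NonConcurrent (Z : Fin 4 ⊕ Fin k → S) (a : Fin 4) : Prop :=
  ∀ y : Fin 3 → ℂ, y ≠ 0 → ∃ b, b ≠ a ∧ eval y (Z (Sum.inl b)) ≠ 0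

/-- Removing the conic contributes at most 3 dimensions, removing the line at most 1, and what
remains has no forms of degree `k`. Since 4 dimensions are present, neither point count can exceed
its Bézout minimum. -/
theorem card_points
    (h : IsSystem Z e φ) (he1 : ∀ a, e (Sum.inl a) = 1) (he2 : ∀ c, e (Sum.inr c) = 2)
    (hlow : 4 ≤ Module.finrank ℂ (logForms Z Finset.univ (k + 3)))
    {a : Fin 4} (ha : NonConcurrent Z a) (c : Fin k) :
    (points Z φ (Sum.inr c) (insert (Sum.inl a) (others a c))).card ≤ 2 * k + 2 ∧
      (points Z φ (Sum.inl a) (others a c)).card ≤ k + 1 := by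
  have hk : 1 ≤ k := c.pos
  have hc : Sum.inr c ∉ insert (Sum.inl a) (others a c) := by
    simp [mem_others]
  have ha' : Sum.inl a ∉ others a c := by
    simp [mem_others]
  have h1 := h.finrank_logForms_insert_le hc (k + 3)
  have h2 := h.finrank_logForms_insert_le ha' (k + 1)
  rw [insert_insert_others, he2, show k + 3 - 2 = k + 1 by omega] at h1
  have h3 : Module.finrank ℂ (logForms Z (others a c) k) = 0 := by
    refine h.logForms_triangle_eq_zero ?_ ?_ ?_ _ ?_ k ?_
    · simp
    · simp [he1]
    · intro y hy
      obtain ⟨b, hb, hby⟩ := ha y hy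
      exact ⟨Sum.inl b, by simpa using hb, hby⟩
    · simp [he2]
    · simp
      omega
  rw [he1, Nat.add_sub_cancel, h3] at h2
  have h4 := h.natDegree_le hc
  have h5 := h.natDegree_le ha'
  have h6 := sum_others he1 he2 a c
  rw [Finset.sum_insert ha', he1, he2] at h4
  rw [he1] at h5
  omega

/-- An intersection number `2 k + 1` spread over at most `k + 1` points of multiplicity at most two
leaves room for only one simple point. -/
theorem not_two_simple_points
    (h : IsSystem Z e φ) (he1 : ∀ a, e (Sum.inl a) = 1) (he2 : ∀ c, e (Sum.inr c) = 2)
    (hlow : 4 ≤ Module.finrank ℂ (logForms Z Finset.univ (k + 3)))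
    {a : Fin 4} (ha : NonConcurrent Z a) (c : Fin k) {t t' : ℂ}
    (hne : t ≠ t') (ht : t ∈ points Z φ (Sum.inl a) (others a c))
    (ht' : t' ∈ points Z φ (Sum.inl a) (others a c))
    (h1 : (∏ j ∈ others a c, aeval (φ (Sum.inl a)) (Z j)).rootMultiplicity t ≤ 1)
    (h1' : (∏ j ∈ others a c, aeval (φ (Sum.inl a)) (Z j)).rootMultiplicity t' ≤ 1) : False := by
  have ha' : Sum.inl a ∉ others a c := by
    simp [mem_others]
  have h2 := h.natDegree_add_card_le ha' {t, t'}
    (Finset.insert_subset ht (Finset.singleton_subset_iff.mpr ht')) (by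
      intro x hx
      rcases Finset.mem_insert.mp hx with rfl | hx
      · exact h1
      · rw [Finset.mem_singleton.mp hx]
        exact h1')
  have h3 := (card_points h he1 he2 hlow ha c).2
  have h6 := sum_others he1 he2 a c
  rw [Finset.card_pair hne, he1] at h2
  omega

/-- At most `2 k + 2` points carry the intersection number `4 k + 4`, so none can have multiplicity
below two. -/
theorem rootMultiplicity_conic
    (h : IsSystem Z e φ) (he1 : ∀ a, e (Sum.inl a) = 1) (he2 : ∀ c, e (Sum.inr c) = 2)
    (hlow : 4 ≤ Module.finrank ℂ (logForms Z Finset.univ (k + 3)))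
    {a : Fin 4} (ha : NonConcurrent Z a) (c : Fin k) {τ : ℂ}
    (hτ : τ ∈ points Z φ (Sum.inr c) (insert (Sum.inl a) (others a c))) :
    2 ≤ (∏ j ∈ insert (Sum.inl a) (others a c),
      aeval (φ (Sum.inr c)) (Z j)).rootMultiplicity τ := by
  by_contra! hlt
  have hc : Sum.inr c ∉ insert (Sum.inl a) (others a c) := by
    simp [mem_others]
  have ha' : Sum.inl a ∉ others a c := by
    simp [mem_others]
  have h2 := h.natDegree_add_card_le hc {τ} (Finset.singleton_subset_iff.mpr hτ) (by
    intro x hx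
    rw [Finset.mem_singleton.mp hx]
    omega)
  have h3 := (card_points h he1 he2 hlow ha c).1
  have h6 := sum_others he1 he2 a c
  rw [Finset.sum_insert ha', Finset.card_singleton, he1, he2] at h2
  omega

/-- The line `a` is tangent to the conic `c`. -/
theorem unique_root_line
    (h : IsSystem Z e φ) (he1 : ∀ a, e (Sum.inl a) = 1) (he2 : ∀ c, e (Sum.inr c) = 2)
    (hlow : 4 ≤ Module.finrank ℂ (logForms Z Finset.univ (k + 3)))
    {a : Fin 4} (ha : NonConcurrent Z a) (c : Fin k) (t₁ t₂ : ℂ)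
    (h₁ : (aeval (φ (Sum.inl a)) (Z (Sum.inr c))).eval t₁ = 0)
    (h₂ : (aeval (φ (Sum.inl a)) (Z (Sum.inr c))).eval t₂ = 0) : t₁ = t₂ := by
  by_contra hne
  have hac : (Sum.inl a : Fin 4 ⊕ Fin k) ≠ Sum.inr c := by simp
  have hc : Sum.inr c ∉ insert (Sum.inl a) (others a c) := by
    simp [mem_others]
  have hc' : Sum.inr c ∉ others a c := by
    simp [mem_others]
  have ha' : Sum.inl a ∉ others a c := by
    simp [mem_others]
  have ha'' : Sum.inl a ∉ insert (Sum.inr c) (others a c) := by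
    simp [mem_others]
  obtain ⟨τ₁, c₁, hc₁, e₁⟩ := h.exists_transfer hac h₁
  obtain ⟨τ₂, c₂, hc₂, e₂⟩ := h.exists_transfer hac h₂
  have hτ : ∀ {t τ c' : ℂ}, c' ≠ 0 →
      (fun i => (φ (Sum.inl a) i).eval t) = c' • (fun i => (φ (Sum.inr c) i).eval τ) →
      (aeval (φ (Sum.inr c)) (Z (Sum.inl a))).eval τ = 0 := by
    intro t τ c' hc' heq
    have := h.eval_self (Sum.inl a) t
    rw [heq, h.eval_smul_eq_zero_iff _ hc'] at this
    rw [eval_aeval_polynomial, this]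
  have hτ₁ := hτ hc₁ e₁
  have hτ₂ := hτ hc₂ e₂
  have hτne : τ₁ ≠ τ₂ := by
    rintro rfl
    refine hne ((h.isParam (Sum.inl a)).injective t₁ t₂ (c₁ * c₂⁻¹) fun i => ?_)
    have g1 := congrFun e₁ i
    have g2 := congrFun e₂ i
    simp only [Pi.smul_apply, smul_eq_mul] at g1 g2
    rw [g1, g2]
    field_simp
  have hF0 := h.aeval_ne_zero hac.symm
  have hsum : (aeval (φ (Sum.inr c)) (Z (Sum.inl a))).rootMultiplicity τ₁ +
      (aeval (φ (Sum.inr c)) (Z (Sum.inl a))).rootMultiplicity τ₂ ≤ 2 := by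
    classical
    have h3 := Polynomial.card_roots' (aeval (φ (Sum.inr c)) (Z (Sum.inl a)))
    rw [h.natDegree_aeval hac.symm, he1, he2] at h3
    rw [← Polynomial.count_roots, ← Polynomial.count_roots, 
      ← Finset.sum_pair (f := fun x => Multiset.count x
        (aeval (φ (Sum.inr c)) (Z (Sum.inl a))).roots) hτne]
    refine le_trans ?_ h3
    rw [← Multiset.toFinset_sum_count_eq]
    apply Finset.sum_le_sum_of_subset
    intro x hx
    rw [Multiset.mem_toFinset, Polynomial.mem_roots hF0]
    rcases Finset.mem_insert.mp hx with rfl | hx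
    · exact hτ₁
    · rw [Finset.mem_singleton.mp hx]
      exact hτ₂
  have hm₁ := h.one_le_rootMultiplicity hac.symm hτ₁
  have hm₂ := h.one_le_rootMultiplicity hac.symm hτ₂
  -- Where the line crosses the conic transversally, another curve must pass, since the conic needs
  -- total multiplicity two. On the line the conic already uses one, so the other curves have
  -- multiplicity at most one there; two such points are impossible.
  have key : ∀ {t τ c' : ℂ}, c' ≠ 0 →
      (fun i => (φ (Sum.inl a) i).eval t) = c' • (fun i => (φ (Sum.inr c) i).eval τ) →
      (aeval (φ (Sum.inr c)) (Z (Sum.inl a))).eval τ = 0 →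
      (aeval (φ (Sum.inl a)) (Z (Sum.inr c))).eval t = 0 →
      (aeval (φ (Sum.inr c)) (Z (Sum.inl a))).rootMultiplicity τ ≤ 1 →
      t ∈ points Z φ (Sum.inl a) (others a c) ∧
      (∏ j ∈ others a c, aeval (φ (Sum.inl a)) (Z j)).rootMultiplicity t ≤ 1 := by
    intro t τ c' hc0 heq hτ0 ht0 hle
    constructor
    · have h4 := rootMultiplicity_conic h he1 he2 hlow ha c (τ := τ)
        ((h.mem_points hc).mpr ⟨_, Finset.mem_insert_self _ _, hτ0⟩)
      rw [Finset.prod_insert ha', Polynomial.rootMultiplicity_mul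
        (mul_ne_zero hF0 (h.prod_ne_zero hc'))] at h4
      have h5 : 0 < (∏ j ∈ others a c, aeval (φ (Sum.inr c)) (Z j)).rootMultiplicity τ := by omega
      have h6 := (Polynomial.rootMultiplicity_pos (h.prod_ne_zero hc')).mp h5
      rw [Polynomial.IsRoot, Polynomial.eval_prod, Finset.prod_eq_zero_iff] at h6
      obtain ⟨j, hj, hj0⟩ := h6
      refine (h.mem_points ha').mpr ⟨j, hj, ?_⟩
      rw [eval_aeval_polynomial, heq, h.eval_smul_eq_zero_iff _ hc0, ← eval_aeval_polynomial, hj0]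
    · have h4 := h.mult _ _ ha'' t
      rw [Finset.prod_insert hc', Polynomial.rootMultiplicity_mul
        (mul_ne_zero (h.aeval_ne_zero hac) (h.prod_ne_zero ha'))] at h4
      have h5 := h.one_le_rootMultiplicity hac ht0
      omega
  obtain ⟨p₁, q₁⟩ := key hc₁ e₁ hτ₁ h₁ (by omega)
  obtain ⟨p₂, q₂⟩ := key hc₂ e₂ hτ₂ h₂ (by omega)
  exact not_two_simple_points h he1 he2 hlow ha c hne p₁ p₂ q₁ q₂

theorem exists_sq
    (h : IsSystem Z e φ) (he1 : ∀ a, e (Sum.inl a) = 1) (he2 : ∀ c, e (Sum.inr c) = 2)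
    (hlow : 4 ≤ Module.finrank ℂ (logForms Z Finset.univ (k + 3)))
    {a : Fin 4} (ha : NonConcurrent Z a) (c : Fin k) :
    ∃ κ τ : ℂ, κ ≠ 0 ∧ aeval (φ (Sum.inr c)) (Z (Sum.inl a)) =
      Polynomial.C κ * (Polynomial.X - Polynomial.C τ) ^ 2 := by
  have hac : (Sum.inl a : Fin 4 ⊕ Fin k) ≠ Sum.inr c := by simp
  obtain ⟨τ, hτ⟩ := h.exists_root hac.symm (by rw [he2]; omega) (by rw [he1]; omega)
  have hu := h.unique_root_symm hac (unique_root_line h he1 he2 hlow ha c)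
  obtain ⟨κ, hκ, heq⟩ := eq_C_mul_pow_of_unique_root (fun x hx => hu x τ hx hτ)
    (h.aeval_ne_zero hac.symm)
  rw [h.natDegree_aeval hac.symm, he1, he2] at heq
  exact ⟨κ, τ, hκ, heq⟩

/-- Three concurrent lines are not all tangent to a smooth conic. -/
theorem not_three_tangents
    (h : IsSystem Z e φ) (he1 : ∀ a, e (Sum.inl a) = 1) (he2 : ∀ c, e (Sum.inr c) = 2)
    (hlow : 4 ≤ Module.finrank ℂ (logForms Z Finset.univ (k + 3)))
    {a b d : Fin 4} (hab : a ≠ b) (had : a ≠ d) (hbd : b ≠ d)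
    (ha : NonConcurrent Z a) (hb : NonConcurrent Z b) (hd : NonConcurrent Z d) (c : Fin k)
    {y : Fin 3 → ℂ} (hy : y ≠ 0) (hya : eval y (Z (Sum.inl a)) = 0)
    (hyb : eval y (Z (Sum.inl b)) = 0) (hyd : eval y (Z (Sum.inl d)) = 0) : False := by
  have hlin : ∀ x, ∃ v, Z (Sum.inl x) = linForm v := fun x =>
    exists_eq_linForm (he1 x ▸ h.isHomogeneous (Sum.inl x))
  choose v hv using hlin
  have hdet : (Matrix.of ![v a, v b, v d]).det = 0 := by
    rw [← Matrix.exists_mulVec_eq_zero_iff]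
    refine ⟨y, hy, ?_⟩
    rw [hv, eval_linForm] at hya hyb hyd
    funext i
    fin_cases i
    · exact hya
    · exact hyb
    · exact hyd
  obtain ⟨w, hw, hw0⟩ := Matrix.exists_vecMul_eq_zero_iff.mpr hdet
  have hrel : C (w 0) * Z (Sum.inl a) + C (w 1) * Z (Sum.inl b) + C (w 2) * Z (Sum.inl d) = 0 := by
    rw [hv, hv, hv, ← linForm_smul, ← linForm_smul, ← linForm_smul, ← linForm_add, ← linForm_add,
      linForm_eq_zero_iff]
    funext i
    have := congrFun hw0 i
    simpa [Matrix.vecMul, dotProduct, Fin.sum_univ_three] using this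
  obtain ⟨κ₁, τ₁, hκ₁, h₁⟩ := exists_sq h he1 he2 hlow ha c
  obtain ⟨κ₂, τ₂, hκ₂, h₂⟩ := exists_sq h he1 he2 hlow hb c
  obtain ⟨κ₃, τ₃, hκ₃, h₃⟩ := exists_sq h he1 he2 hlow hd c
  have hdist : ∀ {x x' : Fin 4} {κ κ' τ : ℂ}, x ≠ x' → κ ≠ 0 → κ' ≠ 0 →
      aeval (φ (Sum.inr c)) (Z (Sum.inl x)) =
        Polynomial.C κ * (Polynomial.X - Polynomial.C τ) ^ 2 →
      aeval (φ (Sum.inr c)) (Z (Sum.inl x')) =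
        Polynomial.C κ' * (Polynomial.X - Polynomial.C τ) ^ 2 → False := by
    intro x x' κ κ' τ hx hκ hκ' e₁ e₂
    have hm := h.mult_pair (i := Sum.inr c) (j := Sum.inl x) (l := Sum.inl x') (by simp) (by simp)
      (by simpa using hx) τ
    have h0 : ∀ x, aeval (φ (Sum.inr c)) (Z (Sum.inl x)) ≠ 0 := fun x => h.aeval_ne_zero (by simp)
    have g1 : 2 ≤ (aeval (φ (Sum.inr c)) (Z (Sum.inl x))).rootMultiplicity τ :=
      (Polynomial.le_rootMultiplicity_iff (h0 x)).mpr (e₁ ▸ dvd_mul_left _ _)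
    have g2 : 2 ≤ (aeval (φ (Sum.inr c)) (Z (Sum.inl x'))).rootMultiplicity τ :=
      (Polynomial.le_rootMultiplicity_iff (h0 x')).mpr (e₂ ▸ dvd_mul_left _ _)
    omega
  have h12 : τ₁ ≠ τ₂ := by
    rintro rfl
    exact hdist hab hκ₁ hκ₂ h₁ h₂
  have h13 : τ₁ ≠ τ₃ := by
    rintro rfl
    exact hdist had hκ₁ hκ₃ h₁ h₃
  have h23 : τ₂ ≠ τ₃ := by
    rintro rfl
    exact hdist hbd hκ₂ hκ₃ h₂ h₃
  -- Restricted to the conic, the relation between the concurrent lines becomes one between the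
  -- squares `(x - τᵢ)²`. For distinct `τᵢ` these are linearly independent: a Vandermonde
  -- elimination isolates each coefficient.
  have hpoly : ∀ x : ℂ, w 0 * κ₁ * (x - τ₁) ^ 2 + w 1 * κ₂ * (x - τ₂) ^ 2 +
      w 2 * κ₃ * (x - τ₃) ^ 2 = 0 := by
    intro x
    have := congrArg (fun F : S => (aeval (φ (Sum.inr c)) F).eval x) hrel
    simp only [map_add, map_mul, h₁, h₂, h₃, map_zero, Polynomial.eval_zero] at this
    simp at this
    linear_combination this
  have q0 := hpoly 0
  have q1 := hpoly 1
  have q2 := hpoly (-1)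
  have s0 : w 0 * κ₁ + w 1 * κ₂ + w 2 * κ₃ = 0 := by linear_combination (q1 + q2) / 2 - q0
  have s1 : w 0 * κ₁ * τ₁ + w 1 * κ₂ * τ₂ + w 2 * κ₃ * τ₃ = 0 := by
    linear_combination (q2 - q1) / 4
  have s2 : w 0 * κ₁ * τ₁ ^ 2 + w 1 * κ₂ * τ₂ ^ 2 + w 2 * κ₃ * τ₃ ^ 2 = 0 := by
    linear_combination q0
  have m1 : w 0 * (κ₁ * ((τ₁ - τ₂) * (τ₁ - τ₃))) = 0 := by
    linear_combination s2 - (τ₂ + τ₃) * s1 + τ₂ * τ₃ * s0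
  have m2 : w 1 * (κ₂ * ((τ₁ - τ₂) * (τ₂ - τ₃))) = 0 := by
    linear_combination -s2 + (τ₁ + τ₃) * s1 - τ₁ * τ₃ * s0
  have m3 : w 2 * (κ₃ * ((τ₁ - τ₃) * (τ₂ - τ₃))) = 0 := by
    linear_combination s2 - (τ₁ + τ₂) * s1 + τ₁ * τ₂ * s0
  have d12 := sub_ne_zero.mpr h12
  have d13 := sub_ne_zero.mpr h13
  have d23 := sub_ne_zero.mpr h23
  apply hw
  funext i
  fin_cases i
  · exact (mul_eq_zero.mp m1).resolve_right (mul_ne_zero hκ₁ (mul_ne_zero d12 d13))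
  · exact (mul_eq_zero.mp m2).resolve_right (mul_ne_zero hκ₂ (mul_ne_zero d12 d23))
  · exact (mul_eq_zero.mp m3).resolve_right (mul_ne_zero hκ₃ (mul_ne_zero d13 d23))

theorem nonConcurrent
    (h : IsSystem Z e φ) (he1 : ∀ a, e (Sum.inl a) = 1) (he2 : ∀ c, e (Sum.inr c) = 2)
    (hlow : 4 ≤ Module.finrank ℂ (logForms Z Finset.univ (k + 3)))
    (hk : 1 ≤ k) (a : Fin 4) : NonConcurrent Z a := by
  by_contra hcon
  rw [NonConcurrent] at hcon
  push Not at hcon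
  obtain ⟨y, hy, hya⟩ := hcon
  have hinl : ∀ {x x' : Fin 4}, x ≠ x' → (Sum.inl x : Fin 4 ⊕ Fin k) ≠ Sum.inl x' :=
    fun hx h' => hx (Sum.inl_injective h')
  -- Two concurrent triples share two lines, hence the same point, which would lie on all four
  -- lines. So in a concurrent triple each line satisfies the hypothesis under which it is tangent
  -- to every conic.
  have hgood : ∀ b, b ≠ a → NonConcurrent Z b := by
    intro b hb
    by_contra hcon
    rw [NonConcurrent] at hcon
    push Not at hcon
    obtain ⟨z, hz, hzb⟩ := hcon
    obtain ⟨i, j, hia, hib, hja, hjb, hij⟩ : ∃ i j : Fin 4,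
        i ≠ a ∧ i ≠ b ∧ j ≠ a ∧ j ≠ b ∧ i ≠ j := by
      clear hya hzb
      revert a b
      decide
    have hyy := h.eval_eq_zero_of_two_lines (hinl hij) (he1 i) (he1 j) hy hz (hya i hia)
      (hya j hja) (hzb i hib) (hzb j hjb) (hzb a hb.symm)
    exact h.not_mem_four (hinl hia.symm) (hinl hb.symm) (hinl hja.symm) (hinl hib) (hinl hij)
      (hinl hjb.symm) hy hyy (hya i hia) (hya b hb) (hya j hja)
  obtain ⟨i, j, l, hi, hj, hl, hij, hil, hjl⟩ : ∃ i j l : Fin 4,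
      i ≠ a ∧ j ≠ a ∧ l ≠ a ∧ i ≠ j ∧ i ≠ l ∧ j ≠ l := by
    clear hya hgood
    revert a
    decide
  exact not_three_tangents h he1 he2 hlow hij hil hjl (hgood i hi) (hgood j hj) (hgood l hl)
    ⟨0, hk⟩ hy (hya i hi) (hya j hj) (hya l hl)

theorem contradiction
    (h : IsSystem Z e φ) (he1 : ∀ a, e (Sum.inl a) = 1) (he2 : ∀ c, e (Sum.inr c) = 2)
    (hlow : 4 ≤ Module.finrank ℂ (logForms Z Finset.univ (k + 3)))
    (hk : 1 ≤ k) : False := by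
  have hnc := nonConcurrent h he1 he2 hlow hk
  have hinl : ∀ {x x' : Fin 4}, x ≠ x' → (Sum.inl x : Fin 4 ⊕ Fin k) ≠ Sum.inl x' :=
    fun hx h' => hx (Sum.inl_injective h')
  let c : Fin k := ⟨0, hk⟩
  have ha' : Sum.inl 0 ∉ others 0 c := by
    simp [mem_others]
  have hthree : ∀ {x x' : Fin 4} {t : ℂ}, x ≠ 0 → x' ≠ 0 → x ≠ x' →
      (aeval (φ (Sum.inl 0)) (Z (Sum.inl x))).eval t = 0 →
      (aeval (φ (Sum.inl 0)) (Z (Sum.inl x'))).eval t = 0 → False := by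
    intro x x' t hx hx' hxx' h1 h2
    obtain ⟨l, hl⟩ : ∃ l : Fin 4, ∀ m, m ≠ l → m = 0 ∨ m = x ∨ m = x' := by
      revert hx hx' hxx'
      clear h1 h2
      revert x x'
      decide
    obtain ⟨m, hm, hm0⟩ := hnc l _ ((h.isParam (Sum.inl 0)).ne_zero t)
    rcases hl m hm with rfl | rfl | rfl
    · exact hm0 (h.eval_self _ t)
    · exact hm0 (by rw [← eval_aeval_polynomial, h1])
    · exact hm0 (by rw [← eval_aeval_polynomial, h2])
  -- No third line passes through a point common to two lines, and a conic through it would be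
  -- tangent to line `0`, making the total multiplicity three.
  have hsimple : ∀ {x : Fin 4} {t : ℂ}, x ≠ 0 →
      (aeval (φ (Sum.inl 0)) (Z (Sum.inl x))).eval t = 0 →
      t ∈ points Z φ (Sum.inl 0) (others 0 c) ∧
      (∏ j ∈ others 0 c, aeval (φ (Sum.inl 0)) (Z j)).rootMultiplicity t ≤ 1 := by
    intro x t hx ht
    have hmem : Sum.inl x ∈ others 0 c := mem_others.mpr ⟨hinl hx, by simp⟩
    refine ⟨(h.mem_points ha').mpr ⟨_, hmem, ht⟩, ?_⟩
    have hF := h.aeval_ne_zero (hinl hx.symm)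
    have ha'' : Sum.inl 0 ∉ (others 0 c).erase (Sum.inl x) := fun hh =>
      ha' (Finset.mem_of_mem_erase hh)
    rw [← Finset.mul_prod_erase _ _ hmem,
      Polynomial.rootMultiplicity_mul (mul_ne_zero hF (h.prod_ne_zero ha''))]
    have hzero : (∏ j ∈ (others 0 c).erase (Sum.inl x),
        aeval (φ (Sum.inl 0)) (Z j)).rootMultiplicity t = 0 := by
      apply Polynomial.rootMultiplicity_eq_zero
      rw [Polynomial.IsRoot, Polynomial.eval_prod, Finset.prod_eq_zero_iff]
      rintro ⟨j, hj, hj0⟩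
      rw [Finset.mem_erase, mem_others] at hj
      rcases j with x' | c'
      · refine hthree hx ?_ ?_ ht hj0
        · rintro rfl
          exact hj.2.1 rfl
        · rintro rfl
          exact hj.1 rfl
      · have hlc : (Sum.inl 0 : Fin 4 ⊕ Fin k) ≠ Sum.inr c' := by simp
        have h2 := rootMultiplicity_eq_natDegree
          (fun y hy => unique_root_line h he1 he2 hlow (hnc 0) c' y t hy hj0)
          (h.aeval_ne_zero hlc)
        rw [h.natDegree_aeval hlc, he1, he2] at h2
        have h3 := h.mult_pair (hinl hx.symm) hlc (by simp) t
        have h4 := h.one_le_rootMultiplicity (hinl hx.symm) ht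
        omega
    have hle := (Multiset.count_le_card t _).trans
      (Polynomial.card_roots' (aeval (φ (Sum.inl 0)) (Z (Sum.inl x))))
    rw [Polynomial.count_roots] at hle
    rw [h.natDegree_aeval (hinl hx.symm), he1, he1] at hle
    omega
  obtain ⟨t₁, ht₁⟩ := h.exists_root (hinl (show (0 : Fin 4) ≠ 1 by decide)) (by rw [he1]; omega)
    (by rw [he1]; omega)
  obtain ⟨t₂, ht₂⟩ := h.exists_root (hinl (show (0 : Fin 4) ≠ 2 by decide)) (by rw [he1]; omega)
    (by rw [he1]; omega)
  have hne : t₁ ≠ t₂ := by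
    rintro rfl
    exact hthree (by decide) (by decide) (by decide) ht₁ ht₂
  obtain ⟨p₁, q₁⟩ := hsimple (by decide) ht₁
  obtain ⟨p₂, q₂⟩ := hsimple (by decide) ht₂
  exact not_two_simple_points h he1 he2 hlow (hnc 0) c hne p₁ p₂ q₁ q₂

end IsSystem

/-! ### Conic-line arrangements as systems of rational curves -/

/-- The extra variable in `Θ` records the degree, so vanishing under `Θ` can be tested on
homogeneous components. The kernel is therefore generated by `P`, and the target is a domain. -/
theorem IsParam.prime {P : S} {e m : ℕ} {φ : Fin 3 → Polynomial ℂ} (h : IsParam P e φ)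
    (hP : P.IsHomogeneous m) (h0 : P ≠ 0) : Prime P := by
  let Θ : S →ₐ[ℂ] Polynomial (Polynomial ℂ) :=
    aeval fun i => Polynomial.X * Polynomial.C (φ i)
  have hΘ : ∀ (G : S) (d : ℕ), G.IsHomogeneous d →
      Θ G = Polynomial.C (aeval φ G) * Polynomial.X ^ d := by
    intro G d hG
    have h1 : aeval (fun i => Polynomial.C (φ i)) G = Polynomial.C (aeval φ G) := by
      have := DFunLike.congr_fun (comp_aeval φ
        (Polynomial.CAlgHom (R := ℂ) (A := Polynomial ℂ))) G
      exact this.symm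
    rw [← h1, mul_comm]
    exact IsHomogeneous.aeval_mul hG _ _
  have hker : ∀ G : S, Θ G = 0 → P ∣ G := by
    intro G hG
    have h1 : ∀ d, aeval φ (homogeneousComponent d G) = 0 := by
      intro d
      by_cases hd : d ∈ Finset.range (G.totalDegree + 1)
      · rw [← sum_homogeneousComponent G, map_sum] at hG
        have h2 := congrArg (fun F : Polynomial (Polynomial ℂ) => F.coeff d) hG
        simp only [Polynomial.finsetSum_coeff, Polynomial.coeff_zero] at h2
        rw [Finset.sum_eq_single d, hΘ _ d (homogeneousComponent_isHomogeneous _ _),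
          Polynomial.coeff_C_mul_X_pow, if_pos rfl] at h2
        · exact h2
        · intro b _ hb
          rw [hΘ _ b (homogeneousComponent_isHomogeneous _ _), Polynomial.coeff_C_mul_X_pow,
            if_neg hb.symm]
        · exact fun hn => absurd hd hn
      · rw [homogeneousComponent_eq_zero _ _ (by simpa using hd), map_zero]
    rw [← sum_homogeneousComponent G]
    exact Finset.dvd_sum fun d _ =>
      h.dvd_of_aeval_eq_zero _ d (homogeneousComponent_isHomogeneous _ _) (h1 d)
  refine ⟨h0, fun hu => ?_, fun a b hab => ?_⟩
  · have h1 := hu.map (aeval φ)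
    rw [h.aeval_eq_zero] at h1
    exact not_isUnit_zero h1
  · obtain ⟨q, hq⟩ := hab
    have h1 : Θ a * Θ b = 0 := by
      rw [← map_mul, hq, map_mul, hΘ P m hP, h.aeval_eq_zero, Polynomial.C_0, zero_mul, zero_mul]
    exact (mul_eq_zero.mp h1).imp (hker a) (hker b)

namespace Arrangement

variable {d k : ℕ} (A : Arrangement d k)

/-- The equations of the lines and of the conics of an arrangement, as one family. -/
def component : Fin d ⊕ Fin k → S := Sum.elim A.line A.conic

/-- The degrees of the components of an arrangement of `d` lines and `k` conics. -/
def componentDegree (d k : ℕ) : Fin d ⊕ Fin k → ℕ := Sum.elim (fun _ => 1) (fun _ => 2)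

theorem equation_eq_prod : A.equation = ∏ i, A.component i := by
  simp [equation, component, Fintype.prod_sum_type]

theorem component_isHomogeneous (i : Fin d ⊕ Fin k) :
    (A.component i).IsHomogeneous (componentDegree d k i) := by
  rcases i with i | i
  · exact A.line_isHomogeneous i
  · exact A.conic_isHomogeneous i

theorem equation_isHomogeneous : A.equation.IsHomogeneous (d + 2 * k) := by
  have h := IsHomogeneous.prod Finset.univ A.component (componentDegree d k)
    fun i _ => A.component_isHomogeneous i
  rw [← equation_eq_prod] at h
  simpa [componentDegree, Fintype.sum_sum_type, mul_comm] using h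

theorem conic_ne_zero (i : Fin k) : A.conic i ≠ 0 := fun h0 => by
  refine A.conic_smooth i 1 one_ne_zero ?_
  simp [IsSingularAt, h0]

theorem component_prime (i : Fin d ⊕ Fin k) : Prime (A.component i) := by
  rcases i with i | i
  · exact prime_of_isHomogeneous_one (A.line_isHomogeneous i) (A.line_ne_zero i)
  · obtain ⟨φ, hφ, -⟩ := exists_isParam_conic (A.conic_isHomogeneous i) (A.conic_smooth i)
      (∅ : Finset (Fin 0)) (fun _ => 0) (fun _ => 0) (fun _ => isHomogeneous_zero _ _ _) (by simp)
    exact hφ.prime (A.conic_isHomogeneous i) (A.conic_ne_zero i)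

theorem not_component_dvd {i j : Fin d ⊕ Fin k} (hij : i ≠ j) :
    ¬ A.component i ∣ A.component j := by
  intro hdvd
  have hass := ((A.component_prime i).dvd_prime_iff_associated (A.component_prime j)).mp hdvd
  rcases i with i | i <;> rcases j with j | j
  · exact A.line_distinct i j (fun h => hij (h ▸ rfl)) hass
  · exact A.line_ne_zero i (eq_zero_of_dvd_of_lt (A.conic_isHomogeneous j)
      (A.line_isHomogeneous i) hass.symm.dvd one_lt_two)
  · exact A.line_ne_zero j (eq_zero_of_dvd_of_lt (A.conic_isHomogeneous i)
      (A.line_isHomogeneous j) hass.dvd one_lt_two)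
  · exact A.conic_distinct i j (fun h => hij (h ▸ rfl)) hass

theorem exists_pderiv_component_ne_zero (i : Fin d ⊕ Fin k) {v : Fin 3 → ℂ} (hv : v ≠ 0) :
    ∃ a, eval v (pderiv a (A.component i)) ≠ 0 := by
  by_contra! hcon
  rcases i with i | i
  · obtain ⟨c, hc⟩ := exists_eq_linForm (A.line_isHomogeneous i)
    refine A.line_ne_zero i ?_
    rw [hc, linForm_eq_zero_iff]
    ext a
    have h := hcon a
    simpa [component, hc, pderiv_linForm] using h
  · refine A.conic_smooth i v hv ⟨?_, hcon⟩
    have h := congrArg (eval v) (A.conic_isHomogeneous i).sum_X_mul_pderiv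
    rw [map_sum, map_nsmul, Finset.sum_eq_zero] at h
    · simpa using h.symm
    · intro a _
      rw [map_mul]
      exact mul_eq_zero_of_right _ (hcon a)

theorem exists_isParam_component (i : Fin d ⊕ Fin k) :
    ∃ φ, IsParam (A.component i) (componentDegree d k i) φ ∧ ∀ j, j ≠ i →
      eval (fun a => (φ a).coeff (componentDegree d k i)) (A.component j) ≠ 0 := by
  have hdvd : ∀ j ∈ Finset.univ.erase i, ¬ A.component i ∣ A.component j := fun j hj =>
    A.not_component_dvd (Finset.ne_of_mem_erase hj).symm
  rcases i with i | i
  · obtain ⟨φ, hφ, h⟩ := exists_isParam_line (A.line_isHomogeneous i) (A.line_ne_zero i)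
      (Finset.univ.erase (Sum.inl i)) A.component _ A.component_isHomogeneous hdvd
    exact ⟨φ, hφ, fun j hj => h j (by simp [hj])⟩
  · obtain ⟨φ, hφ, h⟩ := exists_isParam_conic (A.conic_isHomogeneous i) (A.conic_smooth i)
      (Finset.univ.erase (Sum.inr i)) A.component _ A.component_isHomogeneous hdvd
    exact ⟨φ, hφ, fun j hj => h j (by simp [hj])⟩

theorem exists_isSystem (hA : OnlyNodesTacnodesTriplePoints A.equation) :
    ∃ φ, IsSystem A.component (componentDegree d k) φ := by
  choose φ hφ hinf using A.exists_isParam_component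
  refine ⟨φ, A.component_isHomogeneous, A.component_prime, fun i j => A.not_component_dvd,
    fun i v => A.exists_pderiv_component_ne_zero i, hφ, fun i j hij => hinf i j hij.symm, ?_⟩
  intro i Y hi t
  have hg : (∏ j ∈ Finset.univ.erase i, A.component j).IsHomogeneous
      (∑ j ∈ Finset.univ.erase i, componentDegree d k j) :=
    IsHomogeneous.prod _ _ _ fun j _ => A.component_isHomogeneous j
  have hne : aeval (φ i) (∏ j ∈ Finset.univ.erase i, A.component j) ≠ 0 := fun h0 => by
    obtain ⟨j, hj, hdvd⟩ := (A.component_prime i).exists_mem_finset_dvd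
      ((hφ i).dvd_of_aeval_eq_zero _ _ hg h0)
    exact A.not_component_dvd (Finset.ne_of_mem_erase hj).symm hdvd
  have h2 := rootMultiplicity_le_two hA
    (by rw [equation_eq_prod, Finset.mul_prod_erase _ _ (Finset.mem_univ i)]) (hφ i) hg hne t
  refine le_trans (Polynomial.rootMultiplicity_le_rootMultiplicity_of_dvd hne ?_ t) h2
  rw [map_prod]
  exact Finset.prod_dvd_prod_of_subset _ _ _ fun j hj =>
    Finset.mem_erase.mpr ⟨fun h => hi (h ▸ hj), Finset.mem_univ j⟩

/-- With `m = 2 k + 3`, the dimension of the syzygies grows by at least `3 (k + 2) - (3 k + 5) = 1`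
from degree `k` to `k + 1`, and by at least `3 (k + 3) - (3 k + 6) = 3` in the next step. -/
theorem four_le_finrank_logForms (A : Arrangement 4 k) (hf : IsFree A.equation) :
    4 ≤ Module.finrank ℂ (logForms A.component Finset.univ (k + 3)) := by
  have hm : A.equation.IsHomogeneous ((2 * k + 3) + 1) := by
    convert A.equation_isHomogeneous using 1
    omega
  have h1 := hf.finrank_syzygies_succ hm k
  have h2 := hf.finrank_syzygies_succ hm (k + 1)
  have h3 := finrank_syzygies_le (Y := Finset.univ) A.component_isHomogeneous A.component_prime
    (fun i j => A.not_component_dvd) (A.equation_eq_prod ▸ hm) (k + 2)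
  rw [← equation_eq_prod] at h3
  rw [show k + 1 + 1 = k + 2 from rfl] at h2
  rw [show k + 2 + 1 = k + 3 from rfl] at h3
  omega

end Arrangement

end ConicLine

end

theorem mainTheorem7 (k : ℕ) (hk : 1 ≤ k) (A : ConicLine.Arrangement 4 k)
    (hA : ConicLine.OnlyNodesTacnodesTriplePoints A.equation) :
    ¬ ConicLine.IsFree A.equation := by
  intro hf
  obtain ⟨φ, h⟩ := A.exists_isSystem hA
  exact h.contradiction (fun _ => rfl) (fun _ => rfl) (A.four_le_finrank_logForms hf) hk
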